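/- Let $D=\{z\in\mathbb C:|z|<1,\ \operatorname{Im}z>0\}$, and let $L=\{z\in\mathbb C:|z|=1,\ \operatorname{Im}z>0\}$ be oriented from $1$ to $-1$. Let $\beta\in\mathbb R$, $\beta\neq1$, and $\beta_0=\frac{1+\beta}{1-\beta}$. For $S=L$ or $S=D\cup L\cup(-1,1)$, say that a function is of class $H_b(S)$ if it is Hölder continuous on every compact subset of $S$ and bounded on $S$ (so it is bounded at $\pm1$, but no Hölder condition is imposed there). For real-valued functions $u,v$ on $L$ consider the singular integral equation, with the integral understood as a Cauchy principal value, $$\frac1{2\pi}\int_L\left[\frac{\tau+t}{\tau-t}-\frac{\beta(1+\tau t)}{1-\tau t}\right]\frac{u(\tau)\,d\tau}{\tau}=v(t),\qquad t\in L.\tag{E}$$ Call $(\varphi_1,\varphi_2)$ a Hilbert pair if $\varphi_1,\varphi_2$ are analytic in $D$, are of class $H_b(D\cup L\cup(-1,1))$, and satisfy $$\operatorname{Re}[\varphi_1(x)-\varphi_2(x)]=0,\quad \operatorname{Im}[\beta_0\varphi_1(x)+\varphi_2(x)]=0\quad(-1<x<1),\qquad \operatorname{Re}\varphi_1(t)=0\quad(t\in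 L),$$ $$\lim_{z\to0,\ z\in D}[\varphi_1(z)-\varphi_2(z)]=0.$$ **Theorem 2.1.** (i) If $(\varphi_1,\varphi_2)$ is a Hilbert pair, then $u(t)=\operatorname{Re}\varphi_2(t)$, $t\in L$, is of class $H_b(L)$ and solves (E) with $v(t)=-\operatorname{Im}\varphi_2(t)$. (ii) Conversely, let $\beta\neq-1$, let $v$ be bounded on $L$, and let $u$ be a solution of (E) of class $H_b(L)$. Put $\gamma(z)=\frac{\beta}{2\pi i}[\ln z-\ln(-z)]$, where $\ln$ is the principal branch. Then the functions $$\varphi_1(z)=\frac1{2\pi i}\int_L\left\{[\gamma(z)-\gamma(\tau)]\frac{\tau+z}{\tau-z}+[1-\gamma(z)-\gamma(\tau)]\frac{1+\tau z}{1-\tau z}\right\}\frac{u(\tau)\,d\tau}{\tau},$$ $$\varphi_2(z)=\frac1{2\pi i}\int_L\left\{[1+\gamma(z)-\gamma(\tau)]\frac{\tau+z}{\tau-z}-[\gamma(z)+\gamma(\tau)]\frac{1+\tau z}{1-\tau z}\right\}\frac{u(\tau)\,d\tau}{\tau},\qquad z\in D,$$ extend to $D\cup L\cup(-1,1)$ as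 a Hilbert pair with $\operatorname{Im}\varphi_2(t)=-v(t)$ and $\operatorname{Re}\varphi_2(t)=u(t)$ for $t\in L$. -/

import Mathlib

open Set Filter MeasureTheory
open scoped Topology Real NNReal

noncomputable section

namespace HalfDiscSIE

/-- The open upper half-disc `D`. -/
def halfDisc : Set ℂ := {z | ‖z‖ < 1 ∧ 0 < z.im}

/-- The open upper arc `L` of the unit circle. -/
def arc : Set ℂ := {z | ‖z‖ = 1 ∧ 0 < z.im}

/-- The half-disc together with its boundary, the two corners `1` and `-1` removed:
`D ∪ L ∪ (-1,1)`. -/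
def closedHalfDisc : Set ℂ :=
  halfDisc ∪ arc ∪ ((fun x : ℝ => (x : ℂ)) '' Ioo (-1) 1)

/-- `f` is Hölder continuous on every compact part of `S` (constant and exponent may depend on the
compact part) and bounded on `S`. For `S = L` and for `S = D ∪ L ∪ (-1,1)`, whose only missing
boundary points are `1` and `-1`, this is the class of functions that are Hölder continuous on `S`
and bounded at `1` and `-1`, with no Hölder condition (nor a limit) at these two points. -/
def BoundedHolderOn {E : Type*} [NormedAddCommGroup E] (f : ℂ → E) (S : Set ℂ) : Prop :=
  (∀ K : Set ℂ, K ⊆ S → IsCompact K →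
    ∃ C r : ℝ≥0, 0 < r ∧ r ≤ 1 ∧ HolderOnWith C r f K) ∧
  ∃ M : ℝ, ∀ z ∈ S, ‖f z‖ ≤ M

/-- The point `e^{iθ}`. -/
def circlePt (θ : ℝ) : ℂ := Complex.exp (θ * Complex.I)

/-- The integrand of `∫_L g(τ) dτ` in the parametrization `τ = e^{iθ}`, `dτ = i e^{iθ} dθ`. -/
def arcIntegrand (g : ℂ → ℂ) (θ : ℝ) : ℂ := g (circlePt θ) * (Complex.I * circlePt θ)

/-- The contour integral `∫_L g(τ) dτ` over `L`, from `1` to `-1`. -/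
def arcIntegral (g : ℂ → ℂ) : ℂ := ∫ θ in Ioo 0 π, arcIntegrand g θ

/-- The parameters of the points of `L` at distance greater than `ε` from `t`. -/
def truncatedArc (t : ℂ) (ε : ℝ) : Set ℝ := {θ | θ ∈ Ioo 0 π ∧ ε < ‖circlePt θ - t‖}

/-- The Cauchy principal value at `t` of `∫_L g(τ) dτ` exists and equals `I`. -/
def HasArcPV (g : ℂ → ℂ) (t I : ℂ) : Prop :=
  (∀ ε : ℝ, 0 < ε → IntegrableOn (arcIntegrand g) (truncatedArc t ε)) ∧
  Tendsto (fun ε : ℝ => ∫ θ in truncatedArc t ε, arcIntegrand g θ) (𝓝[>] 0) (𝓝 I)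

/-- The singular integral equation
`(1/2π) ∫_L [(τ+t)/(τ-t) - β(1+τt)/(1-τt)] u(τ) dτ/τ = v(t)`, `t ∈ L`. -/
def SolvesIntegralEquation (β : ℝ) (u v : ℂ → ℝ) : Prop :=
  ∀ t ∈ arc, ∃ I : ℂ,
    HasArcPV (fun τ => ((τ + t) / (τ - t) - β * (1 + τ * t) / (1 - τ * t)) * u τ / τ) t I ∧
    1 / (2 * π) * I = (v t : ℂ)

/-- `φ₁`, `φ₂` are analytic in `D`, Hölder continuous up to `L ∪ (-1,1)`, bounded at `1` and `-1`,
and satisfy the boundary conditions on `(-1,1)`, the condition on `Re φ₁` on `L`, and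
`φ₁ - φ₂ → 0` at the origin. (The remaining condition on `L`, which prescribes either
`Re φ₂ = u` or `Im φ₂ = -v`, is stated separately.) -/
structure IsHilbertPair (β : ℝ) (φ₁ φ₂ : ℂ → ℂ) : Prop where
  analytic₁ : DifferentiableOn ℂ φ₁ halfDisc
  analytic₂ : DifferentiableOn ℂ φ₂ halfDisc
  holder₁ : BoundedHolderOn φ₁ closedHalfDisc
  holder₂ : BoundedHolderOn φ₂ closedHalfDisc
  re_diameter : ∀ x : ℝ, x ∈ Ioo (-1) 1 → (φ₁ x - φ₂ x).re = 0
  im_diameter : ∀ x : ℝ, x ∈ Ioo (-1) 1 →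
    ((((1 + β) / (1 - β) : ℝ) : ℂ) * φ₁ x + φ₂ x).im = 0
  re_arc : ∀ t ∈ arc, (φ₁ t).re = 0
  origin : Tendsto (fun z => φ₁ z - φ₂ z) (𝓝[halfDisc] 0) (𝓝 0)

/-- `γ(z) = (β / 2πi) (ln z - ln (-z))`, with principal branches. -/
def gam (β : ℝ) (z : ℂ) : ℂ :=
  β / (2 * π * Complex.I) * (Complex.log z - Complex.log (-z))

/-- The first Cauchy-type integral. -/
def cauchy₁ (β : ℝ) (u : ℂ → ℝ) (z : ℂ) : ℂ :=
  1 / (2 * π * Complex.I) * arcIntegral (fun τ =>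
    ((gam β z - gam β τ) * ((τ + z) / (τ - z))
      + (1 - gam β z - gam β τ) * ((1 + τ * z) / (1 - τ * z))) * u τ / τ)

/-- The second Cauchy-type integral. -/
def cauchy₂ (β : ℝ) (u : ℂ → ℝ) (z : ℂ) : ℂ :=
  1 / (2 * π * Complex.I) * arcIntegral (fun τ =>
    ((1 + gam β z - gam β τ) * ((τ + z) / (τ - z))
      - (gam β z + gam β τ) * ((1 + τ * z) / (1 - τ * z))) * u τ / τ)

end HalfDiscSIE

end

/-! Extend `u` by zero to the whole unit circle, let `S` be the Schwarz integral of this density,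
and let `S*(z)` be the conjugate of `S` at the conjugate of `z`, which is the Schwarz integral of
the reflected density. In the upper half-plane `gam β` is the constant `β / 2`, so the two
Cauchy-type integrals are just `(1 - β) S*` and `S - β S*`. On the diameter `S*` is the conjugate of
`S`; the diameter conditions follow at once, and the condition at the origin holds because `S 0` is
real. Since `(1 + τ t) / (1 - τ t)` is the Schwarz kernel at the conjugate of `τ`, a Plemelj formula
(`tendsto_truncated`, `hasArcPV`) turns (E) into the statement that `S - β S*` has boundary values
`u - i v` on the arc.

In (ii) the analytic work is regularity. Hölder continuity up to the arc is of Hardy–Littlewood type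
(`exists_holder_of_deriv_le`). Boundedness at the corners is the delicate point, because a bounded
density only gives a derivative of size `M / (1 - ‖z‖)` and hence possibly logarithmic growth.
Boundedness of `S - β S*` on the arc is carried into the half-disc through a primitive
(`exists_norm_schwarz_le`). On the diameter the real and imaginary parts of `S - β S*` are `(1 - β)
Re S` and `(1 + β) Im S`, so `S*` is bounded there when `β ≠ ±1`, and `S*` stays within a bounded
distance of its diameter values (`exists_bound_density₁`).

In (i) two linear combinations of the Hilbert pair are conjugate on the diameter, so they glue by
reflection to one bounded holomorphic function on the disc. Its real part has the zero extension of
`u` as radial limits and its value at `0` is real, so it is `S` (`IsHilbertPair.eqOn_schwarz`). This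
recovers `φ₂ = S - β S*`, and the Plemelj formula gives (E). -/

noncomputable section

namespace HalfDiscSIE

open Complex Metric

/-! ### Schwarz integrals of bounded densities on the circle -/

/-- A real density on the unit circle that is measurable and bounded by `M`. -/
structure IsDensity (w : ℂ → ℝ) (M : ℝ) : Prop where
  meas : AEStronglyMeasurable (fun θ : ℝ => w (circleMap 0 1 θ)) volume
  bound : ∀ ζ ∈ sphere (0 : ℂ) 1, |w ζ| ≤ M

/-- The Schwarz integral of a real density on the unit circle. -/
def schwarz (w : ℂ → ℝ) (z : ℂ) : ℂ :=
  Real.circleAverage (fun ζ => herglotzRieszKernel 0 z ζ • (w ζ : ℂ)) 0 1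

lemma circleMap_mem_unit (θ : ℝ) : circleMap 0 1 θ ∈ sphere (0 : ℂ) 1 :=
  circleMap_mem_sphere 0 zero_le_one θ

lemma intervalIntegrable_of_norm_le {f : ℝ → ℂ} {a b C : ℝ}
    (hf : AEStronglyMeasurable f volume) (h : ∀ θ, ‖f θ‖ ≤ C) :
    IntervalIntegrable f volume a b :=
  (intervalIntegrable_const (c := C)).mono_fun hf.restrict
    (ae_of_all _ fun θ => (h θ).trans (le_abs_self C))

lemma IsDensity.nonneg {w : ℂ → ℝ} {M : ℝ} (hw : IsDensity w M) : 0 ≤ M :=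
  (abs_nonneg _).trans (hw.bound _ (circleMap_mem_unit 0))

lemma IsDensity.circleIntegrable {w : ℂ → ℝ} {M : ℝ} (hw : IsDensity w M) :
    CircleIntegrable (fun ζ => (w ζ : ℂ)) 0 1 :=
  intervalIntegrable_of_norm_le (C := M)
    (Complex.continuous_ofReal.comp_aestronglyMeasurable hw.meas)
    (fun θ => by simpa using hw.bound _ (circleMap_mem_unit θ))

lemma isDensity_const (c : ℝ) : IsDensity (fun _ => c) |c| :=
  ⟨aestronglyMeasurable_const, fun _ _ => le_rfl⟩

lemma IsDensity.add {v w : ℂ → ℝ} {M N : ℝ} (hv : IsDensity v M) (hw : IsDensity w N) :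
    IsDensity (fun ζ => v ζ + w ζ) (M + N) :=
  ⟨hv.meas.add hw.meas, fun ζ hζ => (abs_add_le _ _).trans (add_le_add (hv.bound ζ hζ) (hw.bound ζ hζ))⟩

lemma IsDensity.const_mul {w : ℂ → ℝ} {M : ℝ} (hw : IsDensity w M) (c : ℝ) :
    IsDensity (fun ζ => c * w ζ) (|c| * M) :=
  ⟨hw.meas.const_mul c, fun ζ hζ => by
    rw [abs_mul]; exact mul_le_mul_of_nonneg_left (hw.bound ζ hζ) (abs_nonneg c)⟩

lemma one_sub_norm_le (z : ℂ) {ζ : ℂ} (hζ : ζ ∈ sphere (0 : ℂ) 1) :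
    1 - ‖z‖ ≤ ‖ζ - z‖ := by
  have h := norm_sub_norm_le ζ z
  rw [mem_sphere_zero_iff_norm.1 hζ] at h
  exact h

lemma sub_ne_zero_of_mem {z ζ : ℂ} (hz : ‖z‖ < 1) (hζ : ζ ∈ sphere (0 : ℂ) 1) : ζ - z ≠ 0 :=
  norm_pos_iff.1 (lt_of_lt_of_le (by linarith) (one_sub_norm_le z hζ))

lemma IsDensity.circleIntegrable_kernel {w : ℂ → ℝ} {M : ℝ} (hw : IsDensity w M) {z : ℂ}
    (hz : ‖z‖ < 1) :
    CircleIntegrable (fun ζ => herglotzRieszKernel 0 z ζ • (w ζ : ℂ)) 0 1 :=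
  hw.circleIntegrable.continuousOn_smul
    (continuousOn_herglotzRieszKernel_sphere (by simpa using hz))

lemma hasDerivAt_schwarz {w : ℂ → ℝ} {M : ℝ} (hw : IsDensity w M) {z : ℂ} (hz : ‖z‖ < 1) :
    HasDerivAt (schwarz w)
      (Real.circleAverage (fun ζ => (2 * ζ / (ζ - z) ^ 2) • (w ζ : ℂ)) 0 1) z :=
  hasDerivAt_circleAverage_herglotzRieszKernel_smul hw.circleIntegrable (by simpa using hz)

lemma differentiableOn_schwarz {w : ℂ → ℝ} {M : ℝ} (hw : IsDensity w M) :
    DifferentiableOn ℂ (schwarz w) (ball 0 1) := fun _ hz =>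
  (hasDerivAt_schwarz hw (by simpa using hz)).differentiableAt.differentiableWithinAt

lemma schwarz_add {v w : ℂ → ℝ} {M N : ℝ} (hv : IsDensity v M) (hw : IsDensity w N) {z : ℂ}
    (hz : ‖z‖ < 1) : schwarz (fun ζ => v ζ + w ζ) z = schwarz v z + schwarz w z := by
  unfold schwarz
  rw [← Real.circleAverage_fun_add (hv.circleIntegrable_kernel hz) (hw.circleIntegrable_kernel hz)]
  congr 1; ext ζ; push_cast; rw [smul_add]

lemma schwarz_const_mul (w : ℂ → ℝ) (c : ℝ) (z : ℂ) :
    schwarz (fun ζ => c * w ζ) z = c * schwarz w z := by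
  unfold schwarz
  rw [← smul_eq_mul (c : ℂ), ← Real.circleAverage_fun_smul]
  congr 1; ext ζ; simp only [smul_eq_mul]; push_cast; ring

lemma conj_circleAverage {f : ℂ → ℂ} (hf : CircleIntegrable f 0 1) :
    Real.circleAverage (fun ζ => starRingEnd ℂ (f ζ)) 0 1 =
      starRingEnd ℂ (Real.circleAverage f 0 1) :=
  (Complex.conjCLE : ℂ →L[ℝ] ℂ).circleAverage_comp_comm hf

lemma inv_eq_conj {ζ : ℂ} (hζ : ‖ζ‖ = 1) : ζ⁻¹ = starRingEnd ℂ ζ := by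
  rw [Complex.inv_def, Complex.normSq_eq_norm_sq, hζ]; simp

/-- Reflecting the circle in the real axis does not change averages. -/
lemma circleAverage_comp_conj (f : ℂ → ℂ) :
    Real.circleAverage (fun ζ => f (starRingEnd ℂ ζ)) 0 1 = Real.circleAverage f 0 1 := by
  rw [← Real.circleAverage_zero_one_congr_inv (f := f)]
  refine Real.circleAverage_congr_sphere fun ζ hζ => ?_
  have : ‖ζ‖ = 1 := by simpa using hζ
  simp [inv_eq_conj this]

/-- On the unit circle the conjugate of the kernel is `(1 + c ζ) / (1 - c ζ)` with `c` the conjugate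
of `z`. This is holomorphic on the closed disc, so its average is its value at `0`. -/
lemma circleAverage_herglotzRieszKernel {z : ℂ} (hz : ‖z‖ < 1) :
    Real.circleAverage (herglotzRieszKernel 0 z) 0 1 = 1 := by
  set c := starRingEnd ℂ z with hc
  have hcn : ‖c‖ < 1 := by simpa [hc] using hz
  have hne : ∀ ζ ∈ closedBall (0 : ℂ) 1, 1 - c * ζ ≠ 0 := by
    intro ζ hζ h
    have h1 : ‖c * ζ‖ = 1 := by rw [← sub_eq_zero.1 h]; simp
    rw [norm_mul] at h1
    have : ‖ζ‖ ≤ 1 := by simpa using hζ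
    nlinarith [norm_nonneg c, norm_nonneg ζ]
  have hd : DifferentiableOn ℂ (fun ζ => (1 + c * ζ) / (1 - c * ζ)) (closedBall (0 : ℂ) 1) := by
    intro ζ hζ
    have := hne ζ hζ
    exact DifferentiableAt.differentiableWithinAt (by fun_prop (disch := assumption))
  have hdc : DiffContOnCl ℂ (fun ζ => (1 + c * ζ) / (1 - c * ζ)) (ball (0 : ℂ) |1|) := by
    rw [abs_one]
    exact (hd.mono closure_ball_subset_closedBall).diffContOnCl
  have h := hdc.circleAverage
  have hi : CircleIntegrable (fun ζ => (1 + c * ζ) / (1 - c * ζ)) 0 1 :=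
    (hd.continuousOn.mono sphere_subset_closedBall).circleIntegrable zero_le_one
  have h2 := conj_circleAverage hi
  rw [h] at h2
  simp only [mul_zero, add_zero, sub_zero, div_one, map_one] at h2
  rw [← h2]
  refine Real.circleAverage_congr_sphere fun ζ hζ => ?_
  have hζ1 : ‖ζ‖ = 1 := by simpa using hζ
  have hζ0 : ζ ≠ 0 := norm_ne_zero_iff.1 (by rw [hζ1]; exact one_ne_zero)
  have h3 : ζ - z ≠ 0 := sub_ne_zero_of_mem hz (by simpa using hζ)
  have h4 : (1 - z * ζ⁻¹) ≠ 0 := by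
    intro h; apply h3; field_simp at h; simpa using h
  simp only [herglotzRieszKernel_def, sub_zero, map_div₀, map_add, map_sub, map_mul, map_one, hc,
    Complex.conj_conj, ← inv_eq_conj hζ1]
  field_simp

lemma schwarz_one {z : ℂ} (hz : ‖z‖ < 1) : schwarz (fun _ => 1) z = 1 := by
  unfold schwarz
  simpa using circleAverage_herglotzRieszKernel hz

/-! ### Poisson averages and derivative bounds -/

lemma re_herglotzRieszKernel {z ζ : ℂ} (hζ : ζ ∈ sphere (0 : ℂ) 1) :
    (herglotzRieszKernel 0 z ζ).re = (1 - ‖z‖ ^ 2) * (‖ζ - z‖ ^ 2)⁻¹ := by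
  have := congrFun (poissonKernel_eq_re_herglotzRieszKernel (c := 0) (w := z)) ζ
  rw [Function.comp_apply] at this
  rw [← this, poissonKernel_def, div_eq_mul_inv]
  simp [mem_sphere_zero_iff_norm.1 hζ]

lemma continuousOn_inv_norm_sub_sq {z : ℂ} (hz : ‖z‖ < 1) :
    ContinuousOn (fun ζ : ℂ => (‖ζ - z‖ ^ 2)⁻¹) (sphere 0 1) := by
  refine ContinuousOn.inv₀ (by fun_prop) fun ζ hζ => ?_
  have := sub_ne_zero_of_mem hz hζ
  positivity

lemma circleAverage_inv_norm_sub_sq {z : ℂ} (hz : ‖z‖ < 1) :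
    Real.circleAverage (fun ζ => (‖ζ - z‖ ^ 2)⁻¹) 0 1 = (1 - ‖z‖ ^ 2)⁻¹ := by
  have h1 : CircleIntegrable (herglotzRieszKernel 0 z) 0 1 :=
    ContinuousOn.circleIntegrable zero_le_one
      (by simpa using continuousOn_herglotzRieszKernel_sphere (R := 1) (by simpa using hz))
  have h := Complex.reCLM.circleAverage_comp_comm h1
  rw [circleAverage_herglotzRieszKernel hz] at h
  have h2 : Real.circleAverage (reCLM ∘ herglotzRieszKernel 0 z) 0 1 =
      Real.circleAverage (fun ζ => (1 - ‖z‖ ^ 2) • (‖ζ - z‖ ^ 2)⁻¹) 0 1 := by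
    refine Real.circleAverage_congr_sphere fun ζ hζ => ?_
    simpa using re_herglotzRieszKernel (z := z) (by simpa using hζ)
  rw [h2, Real.circleAverage_fun_smul] at h
  have h3 : (1 - ‖z‖ ^ 2) ≠ 0 := by nlinarith [norm_nonneg z]
  simp only [smul_eq_mul, reCLM_apply, one_re] at h
  exact eq_inv_of_mul_eq_one_right h

lemma norm_circleAverage_le {f : ℂ → ℂ} {g : ℂ → ℝ} (hg : CircleIntegrable g 0 1)
    (h : ∀ ζ ∈ sphere (0 : ℂ) 1, ‖f ζ‖ ≤ g ζ) :
    ‖Real.circleAverage f 0 1‖ ≤ Real.circleAverage g 0 1 := by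
  unfold Real.circleAverage
  rw [norm_smul, Real.norm_of_nonneg (by positivity), smul_eq_mul]
  gcongr
  exact intervalIntegral.norm_integral_le_of_norm_le (by positivity)
    (ae_of_all _ fun θ _ => h _ (circleMap_mem_unit θ)) hg

/-- Every kernel estimate below is reduced to a pointwise comparison with `‖ζ - z‖⁻²`, whose average
is known exactly from the Poisson kernel. -/
lemma norm_circleAverage_le_inv_sq {f : ℂ → ℂ} {z : ℂ} (hz : ‖z‖ < 1) {A B : ℝ}
    (h : ∀ ζ ∈ sphere (0 : ℂ) 1, ‖f ζ‖ ≤ A * (‖ζ - z‖ ^ 2)⁻¹ + B) :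
    ‖Real.circleAverage f 0 1‖ ≤ A * (1 - ‖z‖ ^ 2)⁻¹ + B := by
  have hi : CircleIntegrable (fun ζ : ℂ => A * (‖ζ - z‖ ^ 2)⁻¹) 0 1 :=
    ContinuousOn.circleIntegrable zero_le_one ((continuousOn_inv_norm_sub_sq hz).const_mul _)
  have hB : CircleIntegrable (fun _ : ℂ => B) 0 1 := circleIntegrable_const _ _ _
  refine (norm_circleAverage_le (hi.add hB) h).trans_eq ?_
  rw [Real.circleAverage_add hi hB, Real.circleAverage_const]
  have := Real.circleAverage_fun_smul (a := A) (f := fun ζ : ℂ => (‖ζ - z‖ ^ 2)⁻¹) (c := 0) (R := 1)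
  simp only [smul_eq_mul] at this
  rw [this, circleAverage_inv_norm_sub_sq hz]

/-- Splitting at `x = √δ` trades the weight `‖ζ - z‖ ^ (α - 2)` for a multiple of `‖ζ - z‖⁻²` plus a
constant, so that no further integral has to be computed. The price is the exponent `α / 2` in place
of `α`. -/
lemma rpow_le_add_mul_sq {x δ α : ℝ} (hx : 0 ≤ x) (hδ : 0 < δ) (hα : 0 < α) (hα2 : α ≤ 2) :
    x ^ α ≤ δ ^ (α / 2) + δ ^ (α / 2 - 1) * x ^ 2 := by
  have h0 : δ ^ (α / 2) = (δ ^ (1 / 2 : ℝ)) ^ α := by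
    rw [← Real.rpow_mul hδ.le]; ring_nf
  rcases le_total x (δ ^ (1 / 2 : ℝ)) with h | h
  · have h1 : x ^ α ≤ δ ^ (α / 2) := by
      rw [h0]; exact Real.rpow_le_rpow hx h hα.le
    have : 0 ≤ δ ^ (α / 2 - 1) * x ^ 2 := by positivity
    linarith
  · have hs : 0 < δ ^ (1 / 2 : ℝ) := by positivity
    have hx0 : 0 < x := hs.trans_le h
    have h1 : x ^ (α - 2) ≤ (δ ^ (1 / 2 : ℝ)) ^ (α - 2) :=
      Real.rpow_le_rpow_of_nonpos hs h (by linarith)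
    have h2 : (δ ^ (1 / 2 : ℝ)) ^ (α - 2) = δ ^ (α / 2 - 1) := by
      rw [← Real.rpow_mul hδ.le]; ring_nf
    have h3 : x ^ α = x ^ (α - 2) * x ^ 2 := by
      rw [← Real.rpow_natCast x 2, ← Real.rpow_add hx0]; norm_num
    rw [h3]
    have h4 : x ^ (α - 2) * x ^ 2 ≤ δ ^ (α / 2 - 1) * x ^ 2 := by
      rw [← h2]; gcongr
    have : 0 ≤ δ ^ (α / 2) := by positivity
    linarith

lemma norm_circleAverage_le_rpow {f : ℂ → ℂ} {z : ℂ} (hz : ‖z‖ < 1) {A α : ℝ} (hA : 0 ≤ A)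
    (hα : 0 < α) (hα2 : α ≤ 2)
    (h : ∀ ζ ∈ sphere (0 : ℂ) 1, ‖f ζ‖ ≤ A * (‖ζ - z‖ ^ α * (‖ζ - z‖ ^ 2)⁻¹)) :
    ‖Real.circleAverage f 0 1‖ ≤ 2 * A * (1 - ‖z‖) ^ (α / 2 - 1) := by
  set δ := 1 - ‖z‖ with hδ
  have hδ0 : 0 < δ := by linarith
  have h1 := norm_circleAverage_le_inv_sq (f := f) hz (A := A * δ ^ (α / 2))
    (B := A * δ ^ (α / 2 - 1)) (fun ζ hζ => by
      have hx := one_sub_norm_le z hζ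
      have hx0 : 0 < ‖ζ - z‖ := by linarith
      refine (h ζ hζ).trans ?_
      have h2 := rpow_le_add_mul_sq hx0.le hδ0 hα hα2
      calc A * (‖ζ - z‖ ^ α * (‖ζ - z‖ ^ 2)⁻¹)
          ≤ A * ((δ ^ (α / 2) + δ ^ (α / 2 - 1) * ‖ζ - z‖ ^ 2) * (‖ζ - z‖ ^ 2)⁻¹) := by gcongr
        _ = _ := by field_simp)
  refine h1.trans ?_
  have h3 : (1 - ‖z‖ ^ 2)⁻¹ ≤ δ⁻¹ := by
    apply inv_anti₀ hδ0
    nlinarith [norm_nonneg z]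
  have h4 : δ ^ (α / 2) * δ⁻¹ = δ ^ (α / 2 - 1) := by
    rw [Real.rpow_sub_one hδ0.ne']; rfl
  calc A * δ ^ (α / 2) * (1 - ‖z‖ ^ 2)⁻¹ + A * δ ^ (α / 2 - 1)
      ≤ A * δ ^ (α / 2) * δ⁻¹ + A * δ ^ (α / 2 - 1) := by gcongr
    _ = A * (δ ^ (α / 2) * δ⁻¹) + A * δ ^ (α / 2 - 1) := by ring
    _ = _ := by rw [h4]; ring

lemma norm_kernel_deriv {z ζ : ℂ} (hζ : ζ ∈ sphere (0 : ℂ) 1) :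
    ‖2 * ζ / (ζ - z) ^ 2‖ = 2 * (‖ζ - z‖ ^ 2)⁻¹ := by
  rw [norm_div, norm_mul, mem_sphere_zero_iff_norm.1 hζ, norm_pow, div_eq_mul_inv]
  simp

lemma norm_deriv_schwarz_le {w : ℂ → ℝ} {M : ℝ} (hw : IsDensity w M) {z : ℂ} (hz : ‖z‖ < 1) :
    ‖deriv (schwarz w) z‖ ≤ 2 * M * (1 - ‖z‖)⁻¹ := by
  rw [(hasDerivAt_schwarz hw hz).deriv]
  have h := norm_circleAverage_le_inv_sq (f := fun ζ => (2 * ζ / (ζ - z) ^ 2) • (w ζ : ℂ)) hz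
    (A := 2 * M) (B := 0) (fun ζ hζ => by
      rw [norm_smul, norm_kernel_deriv hζ, Complex.norm_real, Real.norm_eq_abs]
      have := hw.bound ζ hζ
      have h2 : 0 ≤ 2 * (‖ζ - z‖ ^ 2)⁻¹ := by positivity
      nlinarith [mul_le_mul_of_nonneg_left this h2])
  have h3 : (1 - ‖z‖ ^ 2)⁻¹ ≤ (1 - ‖z‖)⁻¹ := by
    apply inv_anti₀ (by linarith)
    nlinarith [norm_nonneg z]
  have := hw.nonneg
  rw [add_zero] at h
  exact h.trans (by gcongr)

lemma IsDensity.sub_const {w : ℂ → ℝ} {M : ℝ} (hw : IsDensity w M) (c : ℝ) :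
    IsDensity (fun ζ => w ζ + -c * 1) (M + |-c| * |1|) :=
  hw.add ((isDensity_const 1).const_mul (-c))

lemma schwarz_sub_const {w : ℂ → ℝ} {M : ℝ} (hw : IsDensity w M) (c : ℝ) {z : ℂ} (hz : ‖z‖ < 1) :
    schwarz (fun ζ => w ζ + -c * 1) z = schwarz w z - c := by
  rw [schwarz_add hw ((isDensity_const 1).const_mul (-c)) hz, schwarz_const_mul, schwarz_one hz]
  push_cast; ring

/-- `w` is Hölder continuous at the point `t` of the unit circle, uniformly on the circle. -/
def HolderAt (w : ℂ → ℝ) (t : ℂ) (C α : ℝ) : Prop :=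
  ∀ ζ ∈ sphere (0 : ℂ) 1, |w ζ - w t| ≤ C * ‖ζ - t‖ ^ α

/-- Since `‖t - z‖ ≤ 1 - ‖z‖ ≤ ‖ζ - z‖`, the distance `‖ζ - t‖` is at most `2 * ‖ζ - z‖`, so the
modulus of continuity at `t` can be measured from `z`. -/
lemma HolderAt.le_norm_sub {w : ℂ → ℝ} {t z ζ : ℂ} {C α : ℝ} (h : HolderAt w t C α) (hC : 0 ≤ C)
    (hα : 0 < α) (hα1 : α ≤ 1) (htz : ‖t - z‖ ≤ 1 - ‖z‖)
    (hζ : ζ ∈ sphere (0 : ℂ) 1) : |w ζ - w t| ≤ 2 * C * ‖ζ - z‖ ^ α := by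
  have h1 := one_sub_norm_le z hζ
  have h2 : ‖ζ - t‖ ≤ 2 * ‖ζ - z‖ := by
    have := norm_sub_le (ζ - z) (t - z)
    rw [sub_sub_sub_cancel_right] at this
    linarith
  calc |w ζ - w t| ≤ C * ‖ζ - t‖ ^ α := h ζ hζ
    _ ≤ C * (2 * ‖ζ - z‖) ^ α := by gcongr
    _ = C * (2 ^ α * ‖ζ - z‖ ^ α) := by rw [Real.mul_rpow zero_le_two (norm_nonneg _)]
    _ ≤ C * (2 ^ (1 : ℝ) * ‖ζ - z‖ ^ α) := by gcongr; norm_num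
    _ = _ := by rw [Real.rpow_one]; ring

/-- Constants have constant Schwarz integral, so `w t` may be subtracted from the density without
changing the derivative. This gains the factor `‖ζ - z‖ ^ α` against the kernel. -/
lemma norm_deriv_schwarz_le_of_holderAt {w : ℂ → ℝ} {M : ℝ} (hw : IsDensity w M) {t z : ℂ}
    {C α : ℝ} (h : HolderAt w t C α) (hC : 0 ≤ C) (hα : 0 < α) (hα1 : α ≤ 1) (hz : ‖z‖ < 1)
    (htz : ‖t - z‖ ≤ 1 - ‖z‖) :
    ‖deriv (schwarz w) z‖ ≤ 8 * C * (1 - ‖z‖) ^ (α / 2 - 1) := by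
  have hd := hasDerivAt_schwarz (hw.sub_const (w t)) hz
  have he : schwarz (fun ζ => w ζ + -(w t) * 1) =ᶠ[𝓝 z] fun z => schwarz w z - w t := by
    filter_upwards [isOpen_ball.mem_nhds (show z ∈ ball (0 : ℂ) 1 by simpa using hz)] with y hy
    exact schwarz_sub_const hw _ (by simpa using hy)
  have h1 : deriv (schwarz w) z = deriv (schwarz (fun ζ => w ζ + -(w t) * 1)) z := by
    rw [he.deriv_eq, deriv_sub_const]
  rw [h1, hd.deriv]
  have := norm_circleAverage_le_rpow
    (f := fun ζ => (2 * ζ / (ζ - z) ^ 2) • ((w ζ + -(w t) * 1 : ℝ) : ℂ)) hz (A := 4 * C) (α := α)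
    (by positivity) hα (by linarith) (fun ζ hζ => by
      rw [norm_smul, norm_kernel_deriv hζ, Complex.norm_real, Real.norm_eq_abs]
      have h2 := h.le_norm_sub hC hα hα1 htz hζ
      have h3 : w ζ + -(w t) * 1 = w ζ - w t := by ring
      rw [h3]
      calc 2 * (‖ζ - z‖ ^ 2)⁻¹ * |w ζ - w t| ≤ 2 * (‖ζ - z‖ ^ 2)⁻¹ * (2 * C * ‖ζ - z‖ ^ α) := by
            gcongr
        _ = _ := by ring)
  refine this.trans_eq (by ring)

/-! ### Truncated kernels and the quantitative Plemelj formula -/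

/-- The Schwarz kernel with pole at the boundary point `t`, cut off near `t`. -/
def truncKernel (t : ℂ) (ε : ℝ) (ζ : ℂ) : ℂ :=
  if ε < ‖ζ - t‖ then herglotzRieszKernel 0 t ζ else 0

lemma measurable_truncKernel (t : ℂ) (ε : ℝ) : Measurable (truncKernel t ε) := by
  refine Measurable.ite (measurableSet_lt measurable_const (by fun_prop)) ?_ measurable_const
  simp only [herglotzRieszKernel_fun_def, sub_zero]
  fun_prop

lemma norm_truncKernel_le {t ζ : ℂ} (ht : ‖t‖ = 1) {ε : ℝ} (hε : 0 < ε)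
    (hζ : ζ ∈ sphere (0 : ℂ) 1) : ‖truncKernel t ε ζ‖ ≤ 2 * ε⁻¹ := by
  unfold truncKernel
  split_ifs with h
  · rw [herglotzRieszKernel_def, norm_div, div_eq_mul_inv]
    simp only [sub_zero]
    have h1 : ‖ζ + t‖ ≤ 2 := by
      have := norm_add_le ζ t
      rw [ht, mem_sphere_zero_iff_norm.1 hζ] at this
      linarith
    gcongr
  · simp; positivity

lemma IsDensity.circleIntegrable_truncKernel {w : ℂ → ℝ} {M : ℝ} (hw : IsDensity w M) {t : ℂ}
    (ht : ‖t‖ = 1) {ε : ℝ} (hε : 0 < ε) :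
    CircleIntegrable (fun ζ => truncKernel t ε ζ • (w ζ : ℂ)) 0 1 := by
  refine intervalIntegrable_of_norm_le (C := 2 * ε⁻¹ * M) ?_ fun θ => ?_
  · exact ((measurable_truncKernel t ε).comp
      (continuous_circleMap 0 1).measurable).aestronglyMeasurable.smul
      (Complex.continuous_ofReal.comp_aestronglyMeasurable hw.meas)
  · rw [norm_smul, Complex.norm_real, Real.norm_eq_abs]
    exact mul_le_mul (norm_truncKernel_le ht hε (circleMap_mem_unit θ))
      (hw.bound _ (circleMap_mem_unit θ)) (abs_nonneg _) (by positivity)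

lemma herglotzRieszKernel_mul {t : ℂ} (ht : t ≠ 0) (a ζ : ℂ) :
    herglotzRieszKernel 0 (a * t) (ζ * t) = herglotzRieszKernel 0 a ζ := by
  simp only [herglotzRieszKernel_def, sub_zero]
  rw [← add_mul, ← sub_mul, mul_div_mul_right _ _ ht]

/-- The principal value of the Schwarz kernel over the whole circle vanishes. -/
lemma circleAverage_truncKernel {t : ℂ} (ht : ‖t‖ = 1) (ε : ℝ) :
    Real.circleAverage (truncKernel t ε) 0 1 = 0 := by
  have ht0 : t ≠ 0 := norm_ne_zero_iff.1 (by rw [ht]; exact one_ne_zero)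
  have h1 : Real.circleAverage (truncKernel t ε) 0 1 = Real.circleAverage (truncKernel 1 ε) 0 1 := by
    rw [Real.circleAverage_eq_integral_add (arg t), Real.circleAverage_def]
    congr 2
    ext θ
    have h2 : circleMap 0 1 (θ + arg t) = circleMap 0 1 θ * t := by
      have : t = Complex.exp (arg t * I) := by
        conv_lhs => rw [← norm_mul_exp_arg_mul_I t, ht]
        simp
      conv_rhs => rw [this]
      simp [circleMap, add_mul, Complex.exp_add]
    have h3 : ‖circleMap 0 1 θ * t - t‖ = ‖circleMap 0 1 θ - 1‖ := by
      rw [← sub_one_mul, norm_mul, ht, mul_one]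
    have h4 := herglotzRieszKernel_mul ht0 1 (circleMap 0 1 θ)
    rw [one_mul] at h4
    rw [h2, truncKernel, truncKernel, h3, h4]
  -- After rotating `t` to `1`: the map `ζ ↦ ζ⁻¹` preserves circle averages and the cutoff, and
  -- changes the sign of `(ζ + 1) / (ζ - 1)`.
  have h2 : Real.circleAverage (truncKernel 1 ε) 0 1 =
      Real.circleAverage (fun ζ => (-1 : ℂ) • truncKernel 1 ε ζ) 0 1 := by
    conv_lhs => rw [← Real.circleAverage_zero_one_congr_inv]
    refine Real.circleAverage_congr_sphere fun ζ hζ => ?_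
    have hζ1 : ‖ζ‖ = 1 := by simpa using hζ
    have hζ0 : ζ ≠ 0 := norm_ne_zero_iff.1 (by rw [hζ1]; exact one_ne_zero)
    have h3 : ‖ζ⁻¹ - 1‖ = ‖ζ - 1‖ := by
      have : ζ⁻¹ - 1 = - ζ⁻¹ * (ζ - 1) := by field_simp; ring
      rw [this, norm_mul, norm_neg, norm_inv, hζ1]; simp
    simp only [truncKernel, h3, smul_ite, smul_zero]
    congr 1
    simp only [herglotzRieszKernel_def, sub_zero]
    rw [smul_eq_mul, ← mul_div_assoc, neg_one_mul]
    rw [← mul_div_mul_right _ _ hζ0, add_mul, sub_mul, inv_mul_cancel₀ hζ0, one_mul,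
      ← neg_div_neg_eq]
    congr 1 <;> ring
  rw [Real.circleAverage_fun_smul, neg_one_smul] at h2
  rw [h1]
  exact self_eq_neg.1 h2

lemma herglotzRieszKernel_sub {ζ t z : ℂ} (ht : ζ - t ≠ 0) (hz : ζ - z ≠ 0) :
    herglotzRieszKernel 0 t ζ - herglotzRieszKernel 0 z ζ =
      2 * ζ * (t - z) / ((ζ - t) * (ζ - z)) := by
  simp only [herglotzRieszKernel_def, sub_zero]
  field_simp
  ring

/-- Outside the cut `‖ζ - z‖ ≤ 2 * ‖ζ - t‖`, which controls the difference of the two kernels.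
Inside it only the kernel at `z` survives; it is at most `2 / ‖ζ - z‖`, and `‖ζ - z‖ ≤ 2 * ε`. -/
lemma norm_truncKernel_sub_le {t z ζ : ℂ} {ε : ℝ} (hε : 0 < ε)
    (hz : ‖z‖ < 1) (htz : ‖t - z‖ = ε) (hζ : ζ ∈ sphere (0 : ℂ) 1) :
    ‖truncKernel t ε ζ - herglotzRieszKernel 0 z ζ‖ ≤ 4 * ε * (‖ζ - z‖ ^ 2)⁻¹ := by
  have hz0 := sub_ne_zero_of_mem hz hζ
  have hx : 0 < ‖ζ - z‖ := norm_pos_iff.2 hz0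
  have htri : ‖ζ - z‖ ≤ ‖ζ - t‖ + ε := by
    rw [← htz]; simpa using norm_add_le (ζ - t) (t - z)
  unfold truncKernel
  split_ifs with h
  · have hy : 0 < ‖ζ - t‖ := hε.trans h
    rw [herglotzRieszKernel_sub (norm_pos_iff.1 hy) hz0, norm_div, norm_mul, norm_mul, norm_mul,
      mem_sphere_zero_iff_norm.1 hζ, htz, ← div_eq_mul_inv, div_le_div_iff₀ (by positivity)
      (by positivity)]
    simp only [Complex.norm_ofNat, mul_one]
    have : ‖ζ - z‖ ≤ 2 * ‖ζ - t‖ := by linarith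
    have h5 : 0 ≤ ε * ‖ζ - z‖ := by positivity
    nlinarith [mul_le_mul_of_nonneg_left this h5]
  · rw [zero_sub, norm_neg, herglotzRieszKernel_def, norm_div, ← div_eq_mul_inv,
      div_le_div_iff₀ (by simpa using hx) (by positivity)]
    simp only [sub_zero]
    have h1 : ‖ζ + z‖ ≤ 2 := by
      have := norm_add_le ζ z
      rw [mem_sphere_zero_iff_norm.1 hζ] at this
      linarith
    have h2 : ‖ζ - z‖ ≤ 2 * ε := by linarith [not_lt.1 h]
    calc ‖ζ + z‖ * ‖ζ - z‖ ^ 2 ≤ 2 * (‖ζ - z‖ * ‖ζ - z‖) := by rw [sq]; gcongr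
      _ ≤ 2 * (2 * ε * ‖ζ - z‖) := by gcongr
      _ = _ := by ring

/-- Quantitative Plemelj formula: the truncated singular integral at `t` and the Schwarz integral
at `(1 - ε) t` differ by the jump `w t` up to a power of `ε`. -/
lemma norm_truncated_sub_schwarz_le {w : ℂ → ℝ} {M : ℝ} (hw : IsDensity w M) {t : ℂ}
    (ht : ‖t‖ = 1) {C α : ℝ} (h : HolderAt w t C α) (hC : 0 ≤ C) (hα : 0 < α) (hα1 : α ≤ 1)
    {ε : ℝ} (hε : 0 < ε) (hε1 : ε < 1) :
    ‖Real.circleAverage (fun ζ => truncKernel t ε ζ • (w ζ : ℂ)) 0 1 -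
      (schwarz w ((1 - ε : ℝ) * t) - w t)‖ ≤ 16 * C * ε ^ (α / 2) := by
  set z : ℂ := (1 - ε : ℝ) * t with hzdef
  have hzn : ‖z‖ = 1 - ε := by
    rw [hzdef, norm_mul, ht, mul_one, Complex.norm_real, Real.norm_of_nonneg (by linarith)]
  have hz : ‖z‖ < 1 := by linarith
  have htz : ‖t - z‖ = ε := by
    have : t - z = (ε : ℂ) * t := by rw [hzdef]; push_cast; ring
    rw [this, norm_mul, ht, mul_one, Complex.norm_real, Real.norm_of_nonneg hε.le]
  have i1 := hw.circleIntegrable_truncKernel ht hε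
  have i2 := hw.circleIntegrable_kernel hz
  have i3 := ((isDensity_const (w t)).circleIntegrable_truncKernel ht hε)
  have i4 := ((isDensity_const (w t)).circleIntegrable_kernel hz)
  -- The constant density `w t` has truncated average `0` but Schwarz integral `w t`; this
  -- discrepancy is the jump term.
  have e : Real.circleAverage (fun ζ => (truncKernel t ε ζ - herglotzRieszKernel 0 z ζ) *
      ((w ζ - w t : ℝ) : ℂ)) 0 1 =
      Real.circleAverage (fun ζ => truncKernel t ε ζ • (w ζ : ℂ)) 0 1 - (schwarz w z - w t) := by
    have e3 : Real.circleAverage (fun ζ => truncKernel t ε ζ • (w t : ℂ)) 0 1 = 0 := by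
      have : (fun ζ => truncKernel t ε ζ • (w t : ℂ)) = fun ζ => (w t : ℂ) • truncKernel t ε ζ := by
        ext ζ; simp only [smul_eq_mul]; ring
      rw [this, Real.circleAverage_fun_smul, circleAverage_truncKernel ht, smul_zero]
    have e4 : Real.circleAverage (fun ζ => herglotzRieszKernel 0 z ζ • (w t : ℂ)) 0 1 = w t := by
      have : (fun ζ => herglotzRieszKernel 0 z ζ • (w t : ℂ)) =
          fun ζ => (w t : ℂ) • herglotzRieszKernel 0 z ζ := by
        ext ζ; simp only [smul_eq_mul]; ring
      rw [this, Real.circleAverage_fun_smul, circleAverage_herglotzRieszKernel hz, smul_eq_mul,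
        mul_one]
    have : (fun ζ => (truncKernel t ε ζ - herglotzRieszKernel 0 z ζ) * ((w ζ - w t : ℝ) : ℂ)) =
        fun ζ => (truncKernel t ε ζ • (w ζ : ℂ) - herglotzRieszKernel 0 z ζ • (w ζ : ℂ)) -
          (truncKernel t ε ζ • (w t : ℂ) - herglotzRieszKernel 0 z ζ • (w t : ℂ)) := by
      ext ζ; simp only [smul_eq_mul]; push_cast; ring
    have i12 : CircleIntegrable (fun ζ => truncKernel t ε ζ • (w ζ : ℂ) -
        herglotzRieszKernel 0 z ζ • (w ζ : ℂ)) 0 1 := i1.sub i2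
    have i34 : CircleIntegrable (fun ζ => truncKernel t ε ζ • (w t : ℂ) -
        herglotzRieszKernel 0 z ζ • (w t : ℂ)) 0 1 := i3.sub i4
    rw [this, Real.circleAverage_fun_sub i12 i34, Real.circleAverage_fun_sub i1 i2,
      Real.circleAverage_fun_sub i3 i4, e3, e4, schwarz]
    ring
  rw [← e]
  have hb := norm_circleAverage_le_rpow
    (f := fun ζ => (truncKernel t ε ζ - herglotzRieszKernel 0 z ζ) * ((w ζ - w t : ℝ) : ℂ))
    hz (A := 8 * C * ε) (α := α) (by positivity) hα (by linarith) (fun ζ hζ => by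
      rw [norm_mul, Complex.norm_real, Real.norm_eq_abs]
      calc _ ≤ 4 * ε * (‖ζ - z‖ ^ 2)⁻¹ * (2 * C * ‖ζ - z‖ ^ α) :=
            mul_le_mul (norm_truncKernel_sub_le hε hz htz hζ)
              (h.le_norm_sub hC hα hα1 (by rw [htz, hzn]; linarith) hζ) (abs_nonneg _)
              (by positivity)
        _ = _ := by ring)
  refine hb.trans_eq ?_
  have : 1 - ‖z‖ = ε := by rw [hzn]; ring
  rw [this, Real.rpow_sub_one hε.ne']
  field_simp
  ring

/-! ### Hölder continuity up to the arc -/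

/-- The closed half-disc without neighbourhoods of the corners `1` and `-1`. -/
def cutHalfDisc (c : ℝ) : Set ℂ := {z | ‖z‖ ≤ 1 ∧ 0 ≤ z.im ∧ |z.re| ≤ 1 - c}

/-- The majorant `g` need only be integrable, and nothing is asked of it at the endpoints, where the
derivative bounds used later degenerate. -/
lemma norm_image_sub_le_of_path {f γ γ' : ℝ → ℂ} {F : ℂ → ℂ} {U : Set ℂ} (hU : IsOpen U)
    (hF : DifferentiableOn ℂ F U) (hf : f = F ∘ γ)
    (hγ : ∀ s, HasDerivAt γ (γ' s) s) (hγ' : Continuous γ') (hmem : ∀ s ∈ Icc (0 : ℝ) 1, γ s ∈ U)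
    {g : ℝ → ℝ} (hg : IntervalIntegrable g volume 0 1)
    (h : ∀ s ∈ Ioo (0 : ℝ) 1, ‖deriv F (γ s)‖ * ‖γ' s‖ ≤ g s) :
    ‖f 1 - f 0‖ ≤ ∫ s in (0 : ℝ)..1, g s := by
  have hγc : Continuous γ := continuous_iff_continuousAt.2 fun s => (hγ s).continuousAt
  have hd : ∀ s ∈ uIcc (0 : ℝ) 1, HasDerivAt f (deriv F (γ s) * γ' s) s := by
    intro s hs
    rw [uIcc_of_le zero_le_one] at hs
    have h1 := (hF.differentiableAt (hU.mem_nhds (hmem s hs))).hasDerivAt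
    rw [hf]
    exact h1.comp s (hγ s)
  have hi : IntervalIntegrable (fun s => deriv F (γ s) * γ' s) volume 0 1 := by
    apply ContinuousOn.intervalIntegrable
    rw [uIcc_of_le zero_le_one]
    exact ((hF.deriv hU).continuousOn.comp hγc.continuousOn hmem).mul hγ'.continuousOn
  rw [← intervalIntegral.integral_eq_sub_of_hasDerivAt hd hi]
  refine intervalIntegral.norm_integral_le_of_norm_le zero_le_one ?_ hg
  filter_upwards [compl_mem_ae_iff.2 (measure_singleton (1 : ℝ))] with s hs hs'
  rw [norm_mul]
  exact h s ⟨hs'.1, lt_of_le_of_ne hs'.2 hs⟩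

lemma convex_cutHalfDisc (c : ℝ) : Convex ℝ (cutHalfDisc c) := by
  have h1 : Convex ℝ {z : ℂ | ‖z‖ ≤ 1} := by
    simpa [closedBall, dist_eq_norm] using convex_closedBall (0 : ℂ) 1
  have h2 : Convex ℝ {z : ℂ | 0 ≤ z.im} := convex_halfSpace_im_ge 0
  have h3 : Convex ℝ {z : ℂ | |z.re| ≤ 1 - c} := by
    have : {z : ℂ | |z.re| ≤ 1 - c} = {z : ℂ | -(1 - c) ≤ z.re} ∩ {z : ℂ | z.re ≤ 1 - c} := by
      ext z; simp [abs_le]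
    rw [this]
    exact (convex_halfSpace_re_ge _).inter (convex_halfSpace_re_le _)
  exact h1.inter (h2.inter h3)

lemma mul_mem_cutHalfDisc {c r : ℝ} {z : ℂ} (hz : z ∈ cutHalfDisc c) (h0 : 0 ≤ r) (h1 : r ≤ 1) :
    (r : ℂ) * z ∈ cutHalfDisc c := by
  obtain ⟨a, b, d⟩ := hz
  refine ⟨?_, ?_, ?_⟩
  · rw [norm_mul, Complex.norm_real, Real.norm_of_nonneg h0]
    nlinarith [norm_nonneg z]
  · rw [Complex.im_ofReal_mul]
    positivity
  · rw [Complex.re_ofReal_mul, abs_mul, abs_of_nonneg h0]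
    nlinarith [abs_nonneg z.re]

/-- A Hardy–Littlewood type lemma: a power bound for the derivative near the circle gives Hölder
continuity up to the circle. -/
lemma exists_holder_of_deriv_le {f : ℂ → ℂ} (hf : DifferentiableOn ℂ f (ball 0 1)) {c C a : ℝ}
    (hC : 0 ≤ C) (ha : 0 < a) (ha1 : a ≤ 1)
    (h : ∀ z ∈ cutHalfDisc c, ‖z‖ < 1 → ‖deriv f z‖ ≤ C * (1 - ‖z‖) ^ (a - 1)) :
    ∃ C', 0 ≤ C' ∧ ∀ p ∈ cutHalfDisc c, ∀ q ∈ cutHalfDisc c, ‖p‖ < 1 → ‖q‖ < 1 →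
      ‖f p - f q‖ ≤ C' * ‖p - q‖ ^ a := by
  set k : ℝ → ℝ := fun s => 2 * (s ^ (a - 1) + (1 - s) ^ (a - 1)) with hk
  have hki : IntervalIntegrable k volume 0 1 := by
    have h1 : IntervalIntegrable (fun s : ℝ => s ^ (a - 1)) volume 0 1 :=
      intervalIntegral.intervalIntegrable_rpow' (by linarith)
    have h2 := (h1.comp_sub_left 1)
    simp only [sub_zero, sub_self] at h2
    exact (h1.add h2.symm).const_mul 2
  have hk0 : 0 ≤ ∫ s in (0 : ℝ)..1, k s :=
    intervalIntegral.integral_nonneg zero_le_one fun s hs => by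
      have := hs.1
      have : 0 ≤ 1 - s := by linarith [hs.2]
      simp only [hk]; positivity
  refine ⟨2 * C * ∫ s in (0 : ℝ)..1, k s, by positivity, fun p hp q hq hp1 hq1 => ?_⟩
  rcases eq_or_ne p q with rfl | hne
  · simp [Real.zero_rpow ha.ne']
  set d := ‖p - q‖ with hd
  have hd0 : 0 < d := norm_pos_iff.2 (sub_ne_zero.2 hne)
  have hd2 : d ≤ 2 := (norm_sub_le _ _).trans (by linarith)
  -- The chord from `q` to `p` is pushed towards the origin so that at time `s` the path is at least
  -- `s * (1 - s) * d` away from the circle. The derivative bound then has the integrable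
  -- singularities `s ^ (a - 1)` and `(1 - s) ^ (a - 1)`. Convexity and scaling keep the path in
  -- `cutHalfDisc c`.
  set γ : ℝ → ℂ := fun s => ((1 - s * (1 - s) * d : ℝ) : ℂ) * (q + s * (p - q)) with hγ
  set γ' : ℝ → ℂ := fun s => ((-(1 - 2 * s) * d : ℝ) : ℂ) * (q + s * (p - q)) +
    ((1 - s * (1 - s) * d : ℝ) : ℂ) * (p - q) with hγ'
  have hconv : ∀ s ∈ Icc (0 : ℝ) 1, q + s * (p - q) ∈ cutHalfDisc c := by
    intro s hs
    have := (convex_cutHalfDisc c) hq hp (show 0 ≤ 1 - s by linarith [hs.2]) hs.1 (by ring)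
    convert this using 1
    simp only [Complex.real_smul]; push_cast; ring
  have hconv1 : ∀ s ∈ Icc (0 : ℝ) 1, ‖q + s * (p - q)‖ < 1 := by
    intro s hs
    have := (convex_ball (0 : ℂ) 1) (show q ∈ ball (0 : ℂ) 1 by simpa using hq1)
      (show p ∈ ball (0 : ℂ) 1 by simpa using hp1) (show 0 ≤ 1 - s by linarith [hs.2]) hs.1 (by ring)
    have h2 : ((1 - s) • q + s • p) = q + s * (p - q) := by
      simp only [Complex.real_smul]; push_cast; ring
    rw [h2] at this
    simpa using this
  have hfac : ∀ s ∈ Icc (0 : ℝ) 1, 0 ≤ s * (1 - s) * d ∧ s * (1 - s) * d ≤ 1 := by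
    intro s hs
    have h1 : 0 ≤ s * (1 - s) := mul_nonneg hs.1 (by linarith [hs.2])
    have h2 : s * (1 - s) ≤ 1 / 4 := by nlinarith [sq_nonneg (s - 1 / 2)]
    exact ⟨by positivity, by nlinarith⟩
  have hnorm : ∀ s ∈ Icc (0 : ℝ) 1, s * (1 - s) * d ≤ 1 - ‖γ s‖ ∧ ‖γ s‖ < 1 := by
    intro s hs
    obtain ⟨h1, h2⟩ := hfac s hs
    have h3 := hconv1 s hs
    have : ‖γ s‖ = (1 - s * (1 - s) * d) * ‖q + s * (p - q)‖ := by
      simp only [hγ]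
      rw [norm_mul, Complex.norm_real, Real.norm_of_nonneg (by linarith)]
    rw [this]
    constructor <;> nlinarith [norm_nonneg (q + s * (p - q))]
  have hder : ∀ s, HasDerivAt γ (γ' s) s := by
    intro s
    have h1 : HasDerivAt (fun s : ℝ => 1 - s * (1 - s) * d) (-(1 - 2 * s) * d) s := by
      have := (((hasDerivAt_id s).mul ((hasDerivAt_id s).const_sub 1)).mul_const d).const_sub 1
      refine this.congr_deriv ?_
      simp only [id_eq]; ring
    have h2 : HasDerivAt (fun s : ℝ => q + s * (p - q)) (p - q) s := by
      simpa using ((hasDerivAt_id s).ofReal_comp.mul_const (p - q)).const_add q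
    exact h1.ofReal_comp.mul h2
  have hbd := norm_image_sub_le_of_path (f := f ∘ γ) (γ' := γ') isOpen_ball hf rfl hder
    (by rw [hγ']; fun_prop) (fun s hs => by simpa using (hnorm s hs).2)
    (g := fun s => 2 * C * d ^ a * k s) (hki.const_mul _) (fun s hs => by
      have hs' : s ∈ Icc (0 : ℝ) 1 := ⟨hs.1.le, hs.2.le⟩
      obtain ⟨h1, h2⟩ := hfac s hs'
      obtain ⟨h3, h4⟩ := hnorm s hs'
      have hs0 := hs.1
      have hs1 : 0 < 1 - s := by linarith [hs.2]
      have hpos : 0 < s * (1 - s) * d := by positivity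
      have hγmem : γ s ∈ cutHalfDisc c :=
        mul_mem_cutHalfDisc (hconv s hs') (by linarith) (by linarith)
      have e1 : ‖deriv f (γ s)‖ ≤ C * (s * (1 - s) * d) ^ (a - 1) :=
        (h _ hγmem h4).trans (by
          exact mul_le_mul_of_nonneg_left
            (Real.rpow_le_rpow_of_nonpos hpos h3 (by linarith)) hC)
      have e2 : ‖γ' s‖ ≤ 2 * d := by
        refine (norm_add_le _ _).trans ?_
        rw [norm_mul, norm_mul, Complex.norm_real, Complex.norm_real, ← hd,
          Real.norm_of_nonneg (by linarith : 0 ≤ 1 - s * (1 - s) * d), Real.norm_eq_abs, abs_mul,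
          abs_of_pos hd0, abs_neg]
        have : |1 - 2 * s| ≤ 1 := by rw [abs_le]; constructor <;> linarith [hs.2]
        have h5 := (hconv1 s hs').le
        have h6 : |1 - 2 * s| * d * ‖q + s * (p - q)‖ ≤ 1 * d * 1 := by gcongr
        nlinarith
      -- One of `s`, `1 - s` is at least `1 / 2`; as `a - 1 ≥ -1`, its power costs at most a factor
      -- `2`.
      have e3 : (s * (1 - s)) ^ (a - 1) ≤ k s := by
        have key : ∀ x y : ℝ, 0 < x → 1 / 2 ≤ y → (x * y) ^ (a - 1) ≤ 2 * x ^ (a - 1) := by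
          intro x y hx hy
          rw [Real.mul_rpow hx.le (by linarith), mul_comm]
          gcongr
          calc y ^ (a - 1) ≤ (1 / 2 : ℝ) ^ (a - 1) :=
                Real.rpow_le_rpow_of_nonpos (by norm_num) hy (by linarith)
            _ ≤ (1 / 2 : ℝ) ^ (-1 : ℝ) :=
                Real.rpow_le_rpow_of_exponent_ge (by norm_num) (by norm_num) (by linarith)
            _ = 2 := by rw [Real.rpow_neg_one]; norm_num
        have p1 : 0 ≤ s ^ (a - 1) := by positivity
        have p2 : 0 ≤ (1 - s) ^ (a - 1) := by positivity
        simp only [hk]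
        rcases le_total s (1 / 2) with hh | hh
        · linarith [key s (1 - s) hs0 (by linarith)]
        · have := key (1 - s) s hs1 hh
          rw [mul_comm (1 - s) s] at this
          linarith
      calc ‖deriv f (γ s)‖ * ‖γ' s‖ ≤ C * (s * (1 - s) * d) ^ (a - 1) * (2 * d) := by gcongr
        _ = 2 * C * (d ^ (a - 1) * d) * (s * (1 - s)) ^ (a - 1) := by
            rw [Real.mul_rpow (by positivity) hd0.le]; ring
        _ = 2 * C * d ^ a * (s * (1 - s)) ^ (a - 1) := by
            rw [Real.rpow_sub_one hd0.ne', div_mul_cancel₀ _ hd0.ne']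
        _ ≤ 2 * C * d ^ a * k s := by gcongr)
  have hγ0 : γ 0 = q := by simp [hγ]
  have hγ1 : γ 1 = p := by simp [hγ]
  rw [Function.comp_apply, Function.comp_apply, hγ0, hγ1] at hbd
  refine hbd.trans_eq ?_
  rw [intervalIntegral.integral_const_mul]
  ring

/-- The density `w` is Hölder continuous at the points of the arc `L`, uniformly on closed
subarcs. -/
def HolderOnArc (w : ℂ → ℝ) : Prop :=
  ∀ m : ℝ, 0 < m → ∃ C α : ℝ, 0 ≤ C ∧ 0 < α ∧ α ≤ 1 ∧
    ∀ t : ℂ, ‖t‖ = 1 → m ≤ t.im → HolderAt w t C α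

lemma half_le_im_of_mem_cutHalfDisc {c : ℝ} (hc : 0 < c) {z : ℂ} (hz : z ∈ cutHalfDisc c)
    (hn : 1 - c / 2 < ‖z‖) : c / 2 ≤ z.im := by
  obtain ⟨-, h2, h3⟩ := hz
  have hc1 : c ≤ 1 := by linarith [abs_nonneg z.re]
  have h4 : ‖z‖ ^ 2 = z.re ^ 2 + z.im ^ 2 := by
    rw [Complex.sq_norm, Complex.normSq_apply]; ring
  have h5 : z.re ^ 2 ≤ (1 - c) ^ 2 := sq_le_sq' (by linarith [(abs_le.1 h3).1]) (abs_le.1 h3).2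
  nlinarith

/-- Where `‖z‖ ≤ 1 - c / 2` the bound for merely bounded densities suffices. Closer to the circle,
being away from the corners forces `z.im ≥ c / 2`, so the radial projection of `z` lies on a closed
subarc with uniform Hölder constants. -/
lemma exists_deriv_schwarz_le {w : ℂ → ℝ} {M : ℝ} (hw : IsDensity w M) (hh : HolderOnArc w)
    {c : ℝ} (hc : 0 < c) : ∃ C a : ℝ, 0 ≤ C ∧ 0 < a ∧ a ≤ 1 ∧
      ∀ z ∈ cutHalfDisc c, ‖z‖ < 1 → ‖deriv (schwarz w) z‖ ≤ C * (1 - ‖z‖) ^ (a - 1) := by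
  obtain ⟨C, α, hC, hα, hα1, h⟩ := hh (c / 2) (by positivity)
  have hM := hw.nonneg
  refine ⟨8 * C + 4 * M / c, α / 2, by positivity, by positivity, by linarith, fun z hz hz1 => ?_⟩
  have hp : 0 ≤ (1 - ‖z‖) ^ (α / 2 - 1) := Real.rpow_nonneg (by linarith) _
  rcases le_or_gt ‖z‖ (1 - c / 2) with hn | hn
  · have h1 := norm_deriv_schwarz_le hw hz1
    have h2 : (1 - ‖z‖)⁻¹ ≤ (c / 2)⁻¹ := inv_anti₀ (by positivity) (by linarith)
    have h3 : 1 ≤ (1 - ‖z‖) ^ (α / 2 - 1) :=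
      Real.one_le_rpow_of_pos_of_le_one_of_nonpos (by linarith) (by linarith [norm_nonneg z])
        (by linarith)
    calc _ ≤ 2 * M * (1 - ‖z‖)⁻¹ := h1
      _ ≤ 2 * M * (c / 2)⁻¹ := by gcongr
      _ = 4 * M / c * 1 := by field_simp; ring
      _ ≤ 4 * M / c * (1 - ‖z‖) ^ (α / 2 - 1) := by gcongr
      _ ≤ _ := by nlinarith [mul_nonneg hC hp]
  · have him := half_le_im_of_mem_cutHalfDisc hc hz hn
    have hz0 : z ≠ 0 := by rintro rfl; simp at him; linarith
    have hzn : 0 < ‖z‖ := norm_pos_iff.2 hz0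
    set t : ℂ := ((‖z‖⁻¹ : ℝ) : ℂ) * z with ht
    have htn : ‖t‖ = 1 := by
      rw [ht, norm_mul, Complex.norm_real, Real.norm_of_nonneg (by positivity),
        inv_mul_cancel₀ hzn.ne']
    have htz : ‖t - z‖ ≤ 1 - ‖z‖ := by
      have : t - z = ((‖z‖⁻¹ - 1 : ℝ) : ℂ) * z := by rw [ht]; push_cast; ring
      have h1 : 1 ≤ ‖z‖⁻¹ := (one_le_inv₀ hzn).2 hz1.le
      rw [this, norm_mul, Complex.norm_real, Real.norm_of_nonneg (by linarith), sub_mul,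
        inv_mul_cancel₀ hzn.ne', one_mul]
    have htim : c / 2 ≤ t.im := by
      rw [ht, Complex.im_ofReal_mul]
      have h1 : 1 ≤ ‖z‖⁻¹ := (one_le_inv₀ hzn).2 hz1.le
      nlinarith
    have h1 := norm_deriv_schwarz_le_of_holderAt hw (h t htn htim) hC hα hα1 hz1 htz
    refine h1.trans ?_
    have : 0 ≤ 4 * M / c := by positivity
    nlinarith [mul_nonneg this hp]

lemma exists_holder_schwarz {w : ℂ → ℝ} {M : ℝ} (hw : IsDensity w M) (hh : HolderOnArc w)
    {c : ℝ} (hc : 0 < c) : ∃ C a : ℝ, 0 ≤ C ∧ 0 < a ∧ a ≤ 1 ∧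
      ∀ p ∈ cutHalfDisc c, ∀ q ∈ cutHalfDisc c, ‖p‖ < 1 → ‖q‖ < 1 →
        ‖schwarz w p - schwarz w q‖ ≤ C * ‖p - q‖ ^ a := by
  obtain ⟨C, a, hC, ha, ha1, h⟩ := exists_deriv_schwarz_le hw hh hc
  obtain ⟨C', hC', h'⟩ := exists_holder_of_deriv_le (differentiableOn_schwarz hw) hC ha ha1 h
  exact ⟨C', a, hC', ha, ha1, h'⟩

/-! ### Radial boundary values -/

/-- The Schwarz integral, extended by its radial limits. -/
def schwarzExt (w : ℂ → ℝ) (z : ℂ) : ℂ :=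
  if ‖z‖ < 1 then schwarz w z else limUnder (𝓝[<] (1 : ℝ)) fun r => schwarz w (r * z)

lemma schwarzExt_of_norm_lt {w : ℂ → ℝ} {z : ℂ} (hz : ‖z‖ < 1) : schwarzExt w z = schwarz w z :=
  if_pos hz

lemma norm_ofReal_mul_lt {r : ℝ} {z : ℂ} (h0 : 0 < r) (h1 : r < 1) (hz : ‖z‖ ≤ 1) :
    ‖(r : ℂ) * z‖ < 1 := by
  rw [norm_mul, Complex.norm_real, Real.norm_of_nonneg h0.le]
  nlinarith [norm_nonneg z]

lemma Ioo_mem_nhdsLT_one : Ioo (0 : ℝ) 1 ∈ 𝓝[<] (1 : ℝ) := Ioo_mem_nhdsLT zero_lt_one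

lemma tendsto_schwarz_radial {w : ℂ → ℝ} {M : ℝ} (hw : IsDensity w M) (hh : HolderOnArc w)
    {c : ℝ} (hc : 0 < c) {z : ℂ} (hz : z ∈ cutHalfDisc c) :
    Tendsto (fun r : ℝ => schwarz w (r * z)) (𝓝[<] 1) (𝓝 (schwarzExt w z)) := by
  by_cases hz1 : ‖z‖ < 1
  · rw [schwarzExt_of_norm_lt hz1]
    have h1 : ContinuousAt (schwarz w) z := (hasDerivAt_schwarz hw hz1).continuousAt
    have h2 : Tendsto (fun r : ℝ => (r : ℂ) * z) (𝓝 1) (𝓝 z) := by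
      have : Continuous fun r : ℝ => (r : ℂ) * z := by fun_prop
      simpa using this.tendsto 1
    exact (h1.tendsto.comp h2).mono_left nhdsWithin_le_nhds
  · obtain ⟨C, a, hC, ha, ha1, h⟩ := exists_holder_schwarz hw hh hc
    -- The Hölder estimate inside the disc, applied along the radius, is a Cauchy criterion as `r →
    -- 1`.
    have hcau : Cauchy (map (fun r : ℝ => schwarz w (r * z)) (𝓝[<] 1)) := by
      rw [Metric.cauchy_iff]
      refine ⟨inferInstance, fun ε hε => ?_⟩
      have ht : Tendsto (fun r : ℝ => C * (1 - r) ^ a) (𝓝[<] 1) (𝓝 0) := by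
        have : Continuous fun r : ℝ => C * (1 - r) ^ a :=
          continuous_const.mul ((continuous_const.sub continuous_id).rpow_const
            fun _ => Or.inr ha.le)
        have := (this.tendsto 1).mono_left (nhdsWithin_le_nhds (s := Iio 1))
        simpa [Real.zero_rpow ha.ne'] using this
      obtain ⟨r₀, hr₀, h0, h1⟩ := ((ht.eventually (gt_mem_nhds hε)).and Ioo_mem_nhdsLT_one).exists
      refine ⟨_, image_mem_map (Ioo_mem_nhdsLT h1), ?_⟩
      rintro _ ⟨r, hr, rfl⟩ _ ⟨s, hs, rfl⟩
      have hr0 := h0.trans hr.1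
      have hs0 := h0.trans hs.1
      rw [dist_eq_norm]
      refine (h _ (mul_mem_cutHalfDisc hz hr0.le hr.2.le) _
        (mul_mem_cutHalfDisc hz hs0.le hs.2.le) (norm_ofReal_mul_lt hr0 hr.2 hz.1)
        (norm_ofReal_mul_lt hs0 hs.2 hz.1)).trans_lt ?_
      refine lt_of_le_of_lt ?_ hr₀
      have : ‖(r : ℂ) * z - s * z‖ ≤ 1 - r₀ := by
        rw [← sub_mul, norm_mul, ← Complex.ofReal_sub, Complex.norm_real, Real.norm_eq_abs]
        have h3 : |r - s| ≤ 1 - r₀ := by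
          rw [abs_le]; constructor <;> linarith [hr.1, hr.2, hs.1, hs.2]
        calc |r - s| * ‖z‖ ≤ (1 - r₀) * 1 := by gcongr; exact hz.1
          _ = _ := mul_one _
      gcongr
    obtain ⟨l, hl⟩ := cauchy_map_iff_exists_tendsto.1 hcau
    rw [schwarzExt, if_neg hz1]
    exact tendsto_nhds_limUnder ⟨l, hl⟩

lemma exists_holder_schwarzExt {w : ℂ → ℝ} {M : ℝ} (hw : IsDensity w M) (hh : HolderOnArc w)
    {c : ℝ} (hc : 0 < c) : ∃ C a : ℝ, 0 ≤ C ∧ 0 < a ∧ a ≤ 1 ∧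
      ∀ p ∈ cutHalfDisc c, ∀ q ∈ cutHalfDisc c,
        ‖schwarzExt w p - schwarzExt w q‖ ≤ C * ‖p - q‖ ^ a := by
  obtain ⟨C, a, hC, ha, ha1, h⟩ := exists_holder_schwarz hw hh hc
  refine ⟨C, a, hC, ha, ha1, fun p hp q hq => ?_⟩
  refine le_of_tendsto ((tendsto_schwarz_radial hw hh hc hp).sub
    (tendsto_schwarz_radial hw hh hc hq)).norm ?_
  filter_upwards [Ioo_mem_nhdsLT_one] with r hr
  refine (h _ (mul_mem_cutHalfDisc hp hr.1.le hr.2.le) _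
    (mul_mem_cutHalfDisc hq hr.1.le hr.2.le) (norm_ofReal_mul_lt hr.1 hr.2 hp.1)
    (norm_ofReal_mul_lt hr.1 hr.2 hq.1)).trans ?_
  have : ‖(r : ℂ) * p - r * q‖ ≤ ‖p - q‖ := by
    rw [← mul_sub, norm_mul, Complex.norm_real, Real.norm_of_nonneg hr.1.le]
    nlinarith [norm_nonneg (p - q), hr.2]
  gcongr

lemma mem_closedHalfDisc_iff {z : ℂ} :
    z ∈ closedHalfDisc ↔ ‖z‖ ≤ 1 ∧ 0 ≤ z.im ∧ |z.re| < 1 := by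
  have hsq : ‖z‖ ^ 2 = z.re ^ 2 + z.im ^ 2 := by
    rw [Complex.sq_norm, Complex.normSq_apply]; ring
  constructor
  · rintro ((⟨h1, h2⟩ | ⟨h1, h2⟩) | ⟨x, hx, rfl⟩)
    · exact ⟨h1.le, h2.le, (Complex.abs_re_le_norm z).trans_lt h1⟩
    · refine ⟨h1.le, h2.le, ?_⟩
      rw [h1] at hsq
      rw [abs_lt]
      constructor <;> nlinarith
    · have : |x| < 1 := abs_lt.2 hx
      refine ⟨?_, ?_, ?_⟩ <;> simp [this, this.le]
  · rintro ⟨h1, h2, h3⟩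
    rcases h2.lt_or_eq with h2 | h2
    · rcases h1.lt_or_eq with h1 | h1
      · exact Or.inl (Or.inl ⟨h1, h2⟩)
      · exact Or.inl (Or.inr ⟨h1, h2⟩)
    · exact Or.inr ⟨z.re, abs_lt.1 h3, Complex.ext (by simp) (by simp [← h2])⟩

lemma cutHalfDisc_subset {c : ℝ} (hc : 0 < c) : cutHalfDisc c ⊆ closedHalfDisc := fun _ hz =>
  mem_closedHalfDisc_iff.2 ⟨hz.1, hz.2.1, by linarith [hz.2.2]⟩

lemma mem_cutHalfDisc_of_mem {z : ℂ} (hz : z ∈ closedHalfDisc) :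
    0 < (1 - |z.re|) ∧ z ∈ cutHalfDisc (1 - |z.re|) := by
  obtain ⟨h1, h2, h3⟩ := mem_closedHalfDisc_iff.1 hz
  exact ⟨by linarith, h1, h2, by linarith⟩

lemma exists_subset_cutHalfDisc {K : Set ℂ} (hK : K ⊆ closedHalfDisc) (hc : IsCompact K) :
    ∃ c, 0 < c ∧ K ⊆ cutHalfDisc c := by
  rcases K.eq_empty_or_nonempty with rfl | hne
  · exact ⟨1, one_pos, empty_subset _⟩
  obtain ⟨x, hx, hmax⟩ := hc.exists_isMaxOn hne (f := fun z : ℂ => |z.re|) (by fun_prop)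
  obtain ⟨h1, -⟩ := mem_cutHalfDisc_of_mem (hK hx)
  refine ⟨1 - |x.re|, h1, fun z hz => ?_⟩
  obtain ⟨h1, h2, h3⟩ := mem_closedHalfDisc_iff.1 (hK hz)
  have := hmax hz
  exact ⟨h1, h2, by simpa using this⟩

lemma arc_subset_closedHalfDisc : arc ⊆ closedHalfDisc := fun _ hz => Or.inl (Or.inr hz)

lemma halfDisc_subset_closedHalfDisc : halfDisc ⊆ closedHalfDisc := fun _ hz => Or.inl (Or.inl hz)

lemma holderOnWith_of_norm_sub_le {E : Type*} [NormedAddCommGroup E] {f : ℂ → E} {K : Set ℂ}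
    {C a : ℝ≥0} (h : ∀ p ∈ K, ∀ q ∈ K, ‖f p - f q‖ ≤ C * ‖p - q‖ ^ (a : ℝ)) :
    HolderOnWith C a f K := by
  intro p hp q hq
  have h1 := h p hp q hq
  rw [edist_nndist, edist_nndist, ← ENNReal.coe_rpow_of_nonneg _ a.coe_nonneg, ← ENNReal.coe_mul,
    ENNReal.coe_le_coe, ← NNReal.coe_le_coe]
  simpa [dist_eq_norm] using h1

lemma HolderOnWith.norm_sub_le {E : Type*} [NormedAddCommGroup E] {f : ℂ → E} {K : Set ℂ}
    {C a : ℝ≥0} (h : HolderOnWith C a f K) {p q : ℂ} (hp : p ∈ K) (hq : q ∈ K) :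
    ‖f p - f q‖ ≤ C * ‖p - q‖ ^ (a : ℝ) := by
  have h1 := h p hp q hq
  rw [edist_nndist, edist_nndist, ← ENNReal.coe_rpow_of_nonneg _ a.coe_nonneg, ← ENNReal.coe_mul,
    ENNReal.coe_le_coe, ← NNReal.coe_le_coe] at h1
  simpa [dist_eq_norm] using h1

/-- Plemelj formula in the limit: truncation at `ε` is compared with the Schwarz integral at radius
`1 - ε`, which tends to the boundary value. -/
lemma tendsto_truncated {w : ℂ → ℝ} {M : ℝ} (hw : IsDensity w M) (hh : HolderOnArc w) {t : ℂ}
    (ht : t ∈ arc) :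
    Tendsto (fun ε : ℝ => Real.circleAverage (fun ζ => truncKernel t ε ζ • (w ζ : ℂ)) 0 1)
      (𝓝[>] 0) (𝓝 (schwarzExt w t - w t)) := by
  obtain ⟨hc, htc⟩ := mem_cutHalfDisc_of_mem (arc_subset_closedHalfDisc ht)
  obtain ⟨C, α, hC, hα, hα1, h⟩ := hh t.im ht.2
  have h1 := tendsto_schwarz_radial hw hh hc htc
  have h2 : Tendsto (fun ε : ℝ => 1 - ε) (𝓝[>] 0) (𝓝[<] 1) := by
    refine tendsto_nhdsWithin_iff.2 ⟨?_, ?_⟩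
    · have : Continuous fun ε : ℝ => 1 - ε := by fun_prop
      simpa using (this.tendsto 0).mono_left (nhdsWithin_le_nhds (s := Ioi 0))
    · filter_upwards [self_mem_nhdsWithin] with ε hε
      simpa using hε
  have h3 := (h1.comp h2).sub_const (w t : ℂ)
  have h4 : Tendsto (fun ε : ℝ => 16 * C * ε ^ (α / 2)) (𝓝[>] 0) (𝓝 0) := by
    have : Continuous fun ε : ℝ => 16 * C * ε ^ (α / 2) :=
      continuous_const.mul (continuous_id.rpow_const fun _ => Or.inr (by positivity))
    have := (this.tendsto 0).mono_left (nhdsWithin_le_nhds (s := Ioi 0))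
    simpa [Real.zero_rpow (half_pos hα).ne'] using this
  have h5 : Tendsto (fun ε : ℝ =>
      Real.circleAverage (fun ζ => truncKernel t ε ζ • (w ζ : ℂ)) 0 1 -
        (schwarz w ((1 - ε : ℝ) * t) - w t)) (𝓝[>] 0) (𝓝 0) := by
    refine squeeze_zero_norm' ?_ h4
    filter_upwards [Ioo_mem_nhdsGT (zero_lt_one' ℝ)] with ε hε
    exact norm_truncated_sub_schwarz_le hw ht.1 (h t ht.1 le_rfl) hC hα hα1 hε.1 hε.2
  have h6 := h5.add h3
  rw [zero_add] at h6
  refine h6.congr fun ε => ?_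
  simp

lemma re_truncKernel {t ζ : ℂ} (ht : ‖t‖ = 1) (ε : ℝ) (hζ : ζ ∈ sphere (0 : ℂ) 1) :
    (truncKernel t ε ζ).re = 0 := by
  unfold truncKernel
  split_ifs
  · rw [re_herglotzRieszKernel hζ, ht]; simp
  · rfl

/-- For `t` on the circle the kernel is purely imaginary on the circle, so all truncated averages
have real part `0` and only the jump contributes. -/
lemma re_schwarzExt_of_mem_arc {w : ℂ → ℝ} {M : ℝ} (hw : IsDensity w M) (hh : HolderOnArc w)
    {t : ℂ} (ht : t ∈ arc) : (schwarzExt w t).re = w t := by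
  have h1 := (Complex.continuous_re.tendsto _).comp (tendsto_truncated hw hh ht)
  have h2 : ∀ᶠ ε : ℝ in 𝓝[>] 0, 0 = (Complex.re ∘ fun ε : ℝ =>
      Real.circleAverage (fun ζ => truncKernel t ε ζ • (w ζ : ℂ)) 0 1) ε := by
    filter_upwards [self_mem_nhdsWithin] with ε hε
    have := Complex.reCLM.circleAverage_comp_comm (hw.circleIntegrable_truncKernel ht.1 hε)
    rw [reCLM_apply] at this
    rw [Function.comp_apply, ← this]
    have h3 : Real.circleAverage (reCLM ∘ fun ζ => truncKernel t ε ζ • (w ζ : ℂ)) 0 1 =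
        Real.circleAverage (fun _ => (0 : ℝ)) 0 1 := by
      refine Real.circleAverage_congr_sphere fun ζ hζ => ?_
      simp [re_truncKernel ht.1 ε (by simpa using hζ)]
    rw [h3, Real.circleAverage_const]
  have h3 := tendsto_nhds_unique (h1.congr' (h2.mono fun _ h => h.symm)) tendsto_const_nhds
  rw [Complex.sub_re, Complex.ofReal_re] at h3
  linarith

/-! ### Boundedness in the half-disc from boundedness on the arc -/

/-- First-order Taylor estimate for a primitive `Q` of `S` under the bound
`‖S'‖ ≤ A / (1 - ‖z‖)`, valid with a constant that does not degenerate at the endpoint. -/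
lemma norm_primitive_sub_le {Q S : ℂ → ℂ} {A : ℝ} (hA : 0 ≤ A)
    (hQ : ∀ z ∈ ball (0 : ℂ) 1, HasDerivAt Q (S z) z) (hS : DifferentiableOn ℂ S (ball 0 1))
    (hS' : ∀ z : ℂ, ‖z‖ < 1 → ‖deriv S z‖ ≤ A * (1 - ‖z‖)⁻¹) {z y : ℂ} (hz : ‖z‖ < 1)
    (hy : ‖y‖ < 1) :
    ‖Q y - Q z - S z * (y - z)‖ ≤ ‖y - z‖ ^ 2 * (A * (1 - ‖z‖)⁻¹) := by
  set γ : ℝ → ℂ := fun s => z + s * (y - z) with hγ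
  have hγn : ∀ s ∈ Icc (0 : ℝ) 1, ‖γ s‖ ≤ (1 - s) * ‖z‖ + s * ‖y‖ := by
    intro s hs
    have : γ s = ((1 - s : ℝ) : ℂ) * z + (s : ℂ) * y := by simp only [hγ]; push_cast; ring
    rw [this]
    refine (norm_add_le _ _).trans_eq ?_
    rw [norm_mul, norm_mul, Complex.norm_real, Complex.norm_real,
      Real.norm_of_nonneg (by linarith [hs.2]), Real.norm_of_nonneg hs.1]
  have hγ1 : ∀ s ∈ Icc (0 : ℝ) 1, ‖γ s‖ < 1 := by
    intro s hs
    have h1 := hγn s hs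
    rcases hs.1.eq_or_lt with h | h
    · rw [← h] at h1 ⊢; simp at h1; linarith
    · nlinarith [hs.2]
  have hγd : ∀ s, HasDerivAt γ (y - z) s := fun s =>
    (((hasDerivAt_id s).ofReal_comp.mul_const (y - z)).const_add z).congr_deriv (by simp)
  -- `F` runs from the Taylor polynomial to `Q y`, and its derivative contains `S'` only with the
  -- factor `1 - s`. This factor absorbs the blow-up, because `1 - ‖γ s‖ ≥ (1 - s) * (1 - ‖z‖)` even
  -- when `y` approaches the circle.
  set F : ℝ → ℂ := fun s => Q (γ s) + ((1 - s : ℝ) : ℂ) * (S (γ s) * (y - z)) with hF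
  have hd : ∀ s ∈ Icc (0 : ℝ) 1,
      HasDerivWithinAt F (((1 - s : ℝ) : ℂ) * (deriv S (γ s) * (y - z) * (y - z))) (Icc 0 1) s := by
    intro s hs
    have hm : γ s ∈ ball (0 : ℂ) 1 := by simpa using hγ1 s hs
    have d1 := (hQ _ hm).comp s (hγd s)
    have d2 := ((hS.differentiableAt (isOpen_ball.mem_nhds hm)).hasDerivAt).comp s (hγd s)
    have d3 : HasDerivAt (fun s : ℝ => 1 - s) (-1) s := by
      simpa using (hasDerivAt_id s).const_sub 1
    refine (d1.add (d3.ofReal_comp.mul (d2.mul_const (y - z)))).hasDerivWithinAt.congr_deriv ?_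
    simp only [Function.comp_apply]
    push_cast
    ring
  have hb : ∀ s ∈ Ico (0 : ℝ) 1,
      ‖((1 - s : ℝ) : ℂ) * (deriv S (γ s) * (y - z) * (y - z))‖ ≤
        ‖y - z‖ ^ 2 * (A * (1 - ‖z‖)⁻¹) := by
    intro s hs
    have hs' : s ∈ Icc (0 : ℝ) 1 := ⟨hs.1, hs.2.le⟩
    have h1 := hS' _ (hγ1 s hs')
    have hs1 : 0 < 1 - s := by linarith [hs.2]
    have hz1 : 0 < 1 - ‖z‖ := by linarith
    have h2 : (1 - ‖γ s‖)⁻¹ ≤ ((1 - s) * (1 - ‖z‖))⁻¹ := by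
      apply inv_anti₀ (by positivity)
      have := hγn s hs'
      nlinarith [hs.1]
    rw [norm_mul, norm_mul, norm_mul, Complex.norm_real, Real.norm_of_nonneg hs1.le]
    calc (1 - s) * (‖deriv S (γ s)‖ * ‖y - z‖ * ‖y - z‖)
        ≤ (1 - s) * (A * ((1 - s) * (1 - ‖z‖))⁻¹ * ‖y - z‖ * ‖y - z‖) := by
          gcongr
          exact h1.trans (by gcongr)
      _ = _ := by field_simp
  have h := norm_image_sub_le_of_norm_deriv_le_segment_01' hd hb
  have e0 : F 0 = Q z + S z * (y - z) := by simp [hF, hγ]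
  have e1 : F 1 = Q y := by simp [hF, hγ]
  rw [e0, e1] at h
  rwa [sub_sub]

lemma circlePt_eq_circleMap (θ : ℝ) : circlePt θ = circleMap 0 1 θ := by
  simp [circlePt, circleMap]

lemma norm_circlePt (θ : ℝ) : ‖circlePt θ‖ = 1 := Complex.norm_exp_ofReal_mul_I θ

lemma circlePt_im (θ : ℝ) : (circlePt θ).im = Real.sin θ := Complex.exp_ofReal_mul_I_im θ

lemma circlePt_mem_arc {θ : ℝ} (hθ : θ ∈ Ioo 0 π) : circlePt θ ∈ arc :=
  ⟨norm_circlePt θ, by rw [circlePt_im]; exact Real.sin_pos_of_mem_Ioo hθ⟩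

lemma hasDerivAt_circlePt (θ : ℝ) : HasDerivAt circlePt (circlePt θ * I) θ := by
  have h1 : HasDerivAt (fun θ : ℝ => (θ : ℂ) * I) I θ := by
    simpa using (hasDerivAt_id θ).ofReal_comp.mul_const I
  exact h1.cexp

lemma continuous_circlePt : Continuous circlePt :=
  continuous_iff_continuousAt.2 fun θ => (hasDerivAt_circlePt θ).continuousAt

lemma norm_circlePt_sub (a b : ℝ) : ‖circlePt a - circlePt b‖ = 2 * |Real.sin ((a - b) / 2)| := by
  have h : circlePt a - circlePt b = circlePt b * (Complex.exp (I * ((a - b : ℝ) : ℂ)) - 1) := by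
    simp only [circlePt]
    rw [mul_sub, ← Complex.exp_add, mul_one]
    congr 2; push_cast; ring
  rw [h, norm_mul, norm_circlePt, one_mul, Complex.norm_exp_I_mul_ofReal_sub_one]
  simp

lemma norm_circlePt_sub_le (a b : ℝ) : ‖circlePt a - circlePt b‖ ≤ |a - b| := by
  rw [norm_circlePt_sub]
  have := Real.abs_sin_le_abs (x := (a - b) / 2)
  rw [abs_div, abs_two] at this
  linarith

lemma le_norm_circlePt_sub {a b : ℝ} (h0 : b ≤ a) (h1 : a - b ≤ 1) :
    (a - b) / 2 ≤ ‖circlePt a - circlePt b‖ := by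
  rw [norm_circlePt_sub]
  have h2 := Real.mul_le_sin (x := (a - b) / 2) (by linarith) (by linarith [Real.pi_gt_three])
  have h3 := le_abs_self (Real.sin ((a - b) / 2))
  have h4 : 1 / 2 ≤ 2 / π := by
    rw [div_le_div_iff₀ (by norm_num) Real.pi_pos]; linarith [Real.pi_le_four]
  nlinarith

/-- Near every point `ρ e^{iφ}` of the half-disc there is a subarc of `L` whose length and distance
from the point are comparable to the distance from the circle. -/
lemma exists_subarc {φ ε : ℝ} (hφ : φ ∈ Icc 0 π) (hε : 0 < ε) (hε1 : ε ≤ 1) :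
    ∃ a b : ℝ, 0 < a ∧ b < π ∧ b - a = ε / 2 ∧ |a - φ| ≤ ε ∧ |b - φ| ≤ ε := by
  have hπ := Real.pi_gt_three
  rcases le_total φ (π / 2) with h | h
  · refine ⟨φ + ε / 2, φ + ε, by linarith [hφ.1], by linarith, by ring, ?_, ?_⟩ <;>
      rw [abs_le] <;> constructor <;> linarith
  · refine ⟨φ - ε, φ - ε / 2, by linarith, by linarith [hφ.2], by ring, ?_, ?_⟩ <;>
      rw [abs_le] <;> constructor <;> linarith

/-- A Schwarz integral of a bounded density whose boundary values on `L` are bounded is bounded in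
the half-disc. -/
lemma exists_norm_schwarz_le {w : ℂ → ℝ} {M B : ℝ} (hw : IsDensity w M) (hh : HolderOnArc w)
    (hB : ∀ t ∈ arc, ‖schwarzExt w t‖ ≤ B) :
    ∃ B', ∀ z : ℂ, ‖z‖ < 1 → 0 ≤ z.im → ‖schwarz w z‖ ≤ B' := by
  obtain ⟨Q, hQ⟩ := (differentiableOn_schwarz hw).isExactOn_ball
  have hM := hw.nonneg
  have hT : ∀ z y : ℂ, ‖z‖ < 1 → ‖y‖ < 1 → _ := fun z y hz hy =>
    norm_primitive_sub_le (A := 2 * M) (by positivity) hQ (differentiableOn_schwarz hw)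
      (fun z hz => norm_deriv_schwarz_le hw hz) hz hy
  -- With `p`, `q` near a subarc at distance comparable to `ε = 1 - ‖z‖`, one has `S z * (p - q) = Q
  -- p - Q q + O(M ε)`. Here `‖Q p - Q q‖ ≤ (B + 1) * ε / 2`, the two Taylor errors total at most
  -- `36 * M * ε`, and `‖p - q‖ ≥ ε / 8`.
  refine ⟨4 * (B + 1) + 288 * M, fun z hz him => ?_⟩
  set ε := 1 - ‖z‖ with hε
  have hε0 : 0 < ε := by linarith
  have hε1 : ε ≤ 1 := by linarith [norm_nonneg z]
  obtain ⟨a, b, ha0, hbπ, hab, haφ, hbφ⟩ := exists_subarc (φ := arg z)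
    ⟨Complex.arg_nonneg_iff.2 him, Complex.arg_le_pi z⟩ hε0 hε1
  have hIcc : ∀ θ ∈ Icc a b, θ ∈ Ioo 0 π := fun θ hθ =>
    ⟨ha0.trans_le hθ.1, hθ.2.trans_lt hbπ⟩
  obtain ⟨c, hc, hcK⟩ := exists_subset_cutHalfDisc (K := circlePt '' Icc a b)
    (by rintro _ ⟨θ, hθ, rfl⟩; exact arc_subset_closedHalfDisc (circlePt_mem_arc (hIcc θ hθ)))
    (isCompact_Icc.image continuous_circlePt)
  obtain ⟨C, α, hC, hα, hα1, hH⟩ := exists_holder_schwarzExt hw hh hc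
  have ht : Tendsto (fun r : ℝ => C * (1 - r) ^ α) (𝓝[<] 1) (𝓝 0) := by
    have : Continuous fun r : ℝ => C * (1 - r) ^ α :=
      continuous_const.mul ((continuous_const.sub continuous_id).rpow_const
        fun _ => Or.inr hα.le)
    have := (this.tendsto 1).mono_left (nhdsWithin_le_nhds (s := Iio 1))
    simpa [Real.zero_rpow hα.ne'] using this
  -- The primitive lives only in the open disc, so the subarc is shrunk to a radius `r` at which
  -- `schwarz w` is within `1` of its boundary values. `r` depends on `z`, the final bound does not.
  obtain ⟨r, hr1, hr2, hr3⟩ := ((ht.eventually (gt_mem_nhds one_pos)).and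
    ((Ioo_mem_nhdsLT (show max (1 / 2) (1 - ε) < 1 by
      rw [max_lt_iff]; constructor <;> linarith)))).exists
  rw [max_lt_iff] at hr2
  have hr0 : 0 < r := by linarith [hr2.1]
  have hrn : ∀ θ : ℝ, ‖(r : ℂ) * circlePt θ‖ < 1 := fun θ =>
    norm_ofReal_mul_lt hr0 hr3 (norm_circlePt θ).le
  have hSb : ∀ θ ∈ Icc a b, ‖schwarz w (r * circlePt θ)‖ ≤ B + 1 := by
    intro θ hθ
    have hm := hcK ⟨θ, hθ, rfl⟩
    have h1 := hH _ (mul_mem_cutHalfDisc hm hr0.le hr3.le) _ hm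
    rw [schwarzExt_of_norm_lt (hrn θ)] at h1
    have h2 : ‖(r : ℂ) * circlePt θ - circlePt θ‖ = 1 - r := by
      rw [← sub_one_mul, norm_mul, norm_circlePt, mul_one, ← Complex.ofReal_one,
        ← Complex.ofReal_sub, Complex.norm_real, Real.norm_eq_abs, abs_of_neg (by linarith)]
      ring
    rw [h2] at h1
    have h3 := hB _ (circlePt_mem_arc (hIcc θ hθ))
    have h4 := norm_add_le (schwarz w (r * circlePt θ) - schwarzExt w (circlePt θ))
      (schwarzExt w (circlePt θ))
    rw [sub_add_cancel] at h4
    linarith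
  have hQd : ‖Q (r * circlePt b) - Q (r * circlePt a)‖ ≤ (B + 1) * (b - a) := by
    refine norm_image_sub_le_of_norm_deriv_le_segment' (f := fun θ => Q (r * circlePt θ))
      (f' := fun θ => schwarz w (r * circlePt θ) * (r * (circlePt θ * I))) (a := a) (b := b)
      (fun θ _ => ?_) (fun θ hθ => ?_) b ⟨by linarith, le_rfl⟩
    · exact ((hQ _ (by simpa using hrn θ)).comp θ
        ((hasDerivAt_circlePt θ).const_mul (r : ℂ))).hasDerivWithinAt
    · have h1 := hSb θ ⟨hθ.1, hθ.2.le⟩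
      rw [norm_mul, norm_mul, norm_mul, norm_circlePt, Complex.norm_I, Complex.norm_real,
        Real.norm_of_nonneg hr0.le]
      nlinarith [norm_nonneg (schwarz w (r * circlePt θ))]
  have hdist : ∀ θ : ℝ, |θ - arg z| ≤ ε → ‖(r : ℂ) * circlePt θ - z‖ ≤ 3 * ε := by
    intro θ hθ
    have e1 : ‖(r : ℂ) * circlePt θ - circlePt θ‖ ≤ ε := by
      rw [← sub_one_mul, norm_mul, norm_circlePt, mul_one, ← Complex.ofReal_one,
        ← Complex.ofReal_sub, Complex.norm_real, Real.norm_eq_abs, abs_of_neg (by linarith)]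
      linarith [hr2.2]
    have e2 : ‖circlePt θ - circlePt (arg z)‖ ≤ ε := (norm_circlePt_sub_le _ _).trans hθ
    have e3 : ‖circlePt (arg z) - z‖ ≤ ε := by
      have : circlePt (arg z) - z = ((1 - ‖z‖ : ℝ) : ℂ) * circlePt (arg z) := by
        have h := Complex.norm_mul_exp_arg_mul_I z
        simp only [circlePt]; push_cast; rw [sub_mul, one_mul, h]
      rw [this, norm_mul, norm_circlePt, mul_one, Complex.norm_real, Real.norm_of_nonneg hε0.le]
    have e4 : (r : ℂ) * circlePt θ - z = (r * circlePt θ - circlePt θ) +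
        (circlePt θ - circlePt (arg z)) + (circlePt (arg z) - z) := by ring
    rw [e4]
    exact (norm_add₃_le).trans (by linarith)
  have hta := hT z _ hz (hrn a)
  have htb := hT z _ hz (hrn b)
  have hsq : ∀ θ : ℝ, |θ - arg z| ≤ ε →
      ‖(r : ℂ) * circlePt θ - z‖ ^ 2 * (2 * M * ε⁻¹) ≤ 18 * M * ε := by
    intro θ hθ
    have h1 := hdist θ hθ
    calc _ ≤ (3 * ε) ^ 2 * (2 * M * ε⁻¹) := by gcongr
      _ = _ := by field_simp; ring
  have hA := hta.trans (hsq a haφ)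
  have hBb := htb.trans (hsq b hbφ)
  have hlen : ε / 8 ≤ ‖(r : ℂ) * circlePt b - r * circlePt a‖ := by
    rw [← mul_sub, norm_mul, Complex.norm_real, Real.norm_of_nonneg hr0.le]
    have := le_norm_circlePt_sub (a := b) (b := a) (by linarith) (by linarith)
    nlinarith [hr2.1]
  have hfin : schwarz w z * (r * circlePt b - r * circlePt a) =
      (Q (r * circlePt b) - Q (r * circlePt a)) +
      (Q (r * circlePt a) - Q z - schwarz w z * (r * circlePt a - z)) -
      (Q (r * circlePt b) - Q z - schwarz w z * (r * circlePt b - z)) := by ring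
  have hn := congrArg norm hfin
  rw [norm_mul] at hn
  have h5 := norm_sub_le ((Q (r * circlePt b) - Q (r * circlePt a)) +
      (Q (r * circlePt a) - Q z - schwarz w z * (r * circlePt a - z)))
      (Q (r * circlePt b) - Q z - schwarz w z * (r * circlePt b - z))
  have h6 := norm_add_le (Q (r * circlePt b) - Q (r * circlePt a))
      (Q (r * circlePt a) - Q z - schwarz w z * (r * circlePt a - z))
  rw [hab] at hQd
  have h7 : ‖schwarz w z‖ * (ε / 8) ≤ (B + 1) * (ε / 2) + 36 * M * ε := by
    calc _ ≤ ‖schwarz w z‖ * ‖(r : ℂ) * circlePt b - r * circlePt a‖ := by gcongr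
      _ ≤ _ := by linarith
  have h8 : ‖schwarz w z‖ * (ε / 8) ≤ (4 * (B + 1) + 288 * M) * (ε / 8) := by
    refine h7.trans_eq ?_; ring
  exact le_of_mul_le_mul_right h8 (by positivity)

/-! ### Densities coming from functions on the arc -/

/-- A closed subarc of `L`. -/
def upperArc (m : ℝ) : Set ℂ := {z | ‖z‖ = 1 ∧ m ≤ z.im}

lemma isCompact_upperArc (m : ℝ) : IsCompact (upperArc m) := by
  refine (isCompact_sphere (0 : ℂ) 1).of_isClosed_subset ?_ fun z hz => by simpa using hz.1
  exact (isClosed_eq continuous_norm continuous_const).inter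
    (isClosed_le continuous_const Complex.continuous_im)

lemma upperArc_subset {m : ℝ} (hm : 0 < m) : upperArc m ⊆ arc := fun _ hz =>
  ⟨hz.1, hm.trans_le hz.2⟩

lemma isCompact_cutHalfDisc (c : ℝ) : IsCompact (cutHalfDisc c) := by
  refine (isCompact_closedBall (0 : ℂ) 1).of_isClosed_subset ?_ fun z hz => by simpa using hz.1
  exact (isClosed_le continuous_norm continuous_const).inter
    ((isClosed_le continuous_const Complex.continuous_im).inter
      (isClosed_le Complex.continuous_re.abs continuous_const))

lemma BoundedHolderOn.continuousWithinAt {E : Type*} [NormedAddCommGroup E] {f : ℂ → E}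
    {S K : Set ℂ} (hf : BoundedHolderOn f S) (hKS : K ⊆ S) (hK : IsCompact K) {x : ℂ}
    (hxS : x ∈ S) (hx : K ∈ 𝓝[S] x) : ContinuousWithinAt f S x := by
  obtain ⟨C, r, hr, -, h⟩ := hf.1 K hKS hK
  exact ((h.continuousOn hr) x (mem_of_mem_nhdsWithin hxS hx)).mono_of_mem_nhdsWithin hx

lemma BoundedHolderOn.continuousOn_arc {E : Type*} [NormedAddCommGroup E] {f : ℂ → E}
    (hf : BoundedHolderOn f arc) : ContinuousOn f arc := by
  intro x hx
  refine hf.continuousWithinAt (upperArc_subset (half_pos hx.2)) (isCompact_upperArc _) hx ?_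
  have : {z : ℂ | x.im / 2 < z.im} ∈ 𝓝 x :=
    (isOpen_lt continuous_const Complex.continuous_im).mem_nhds (half_lt_self hx.2)
  filter_upwards [mem_nhdsWithin_of_mem_nhds this, self_mem_nhdsWithin] with z h1 h2
  exact ⟨h2.1, le_of_lt h1⟩

lemma BoundedHolderOn.continuousOn_closedHalfDisc {E : Type*} [NormedAddCommGroup E] {f : ℂ → E}
    (hf : BoundedHolderOn f closedHalfDisc) : ContinuousOn f closedHalfDisc := by
  intro x hx
  obtain ⟨hc, -⟩ := mem_cutHalfDisc_of_mem hx
  refine hf.continuousWithinAt (cutHalfDisc_subset (half_pos hc)) (isCompact_cutHalfDisc _) hx ?_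
  have : {z : ℂ | |z.re| < 1 - (1 - |x.re|) / 2} ∈ 𝓝 x :=
    (isOpen_lt Complex.continuous_re.abs continuous_const).mem_nhds
      (show |x.re| < 1 - (1 - |x.re|) / 2 by linarith)
  filter_upwards [mem_nhdsWithin_of_mem_nhds this, self_mem_nhdsWithin] with z h1 h2
  obtain ⟨h3, h4, -⟩ := mem_closedHalfDisc_iff.1 h2
  exact ⟨h3, h4, le_of_lt h1⟩

lemma BoundedHolderOn.isDensity {u : ℂ → ℝ} (hu : BoundedHolderOn u arc) :
    ∃ M, IsDensity (arc.indicator u) M := by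
  obtain ⟨M, hM⟩ := hu.2
  refine ⟨|M|, ?_, fun ζ _ => ?_⟩
  · set s : Set ℝ := {θ | circleMap 0 1 θ ∈ arc} with hs
    have hso : IsOpen s := by
      have : s = {θ : ℝ | 0 < (circleMap 0 1 θ).im} := by
        ext θ; simp [hs, arc]
      rw [this]
      exact isOpen_lt continuous_const (Complex.continuous_im.comp (continuous_circleMap 0 1))
    have : (fun θ : ℝ => arc.indicator u (circleMap 0 1 θ)) =
        s.indicator (fun θ => u (circleMap 0 1 θ)) := by
      rfl
    rw [this, aestronglyMeasurable_indicator_iff hso.measurableSet]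
    exact (hu.continuousOn_arc.comp (continuous_circleMap 0 1).continuousOn
      fun θ hθ => hθ).aestronglyMeasurable hso.measurableSet
  · by_cases h : ζ ∈ arc
    · rw [indicator_of_mem h]; exact (hM ζ h).trans (le_abs_self M)
    · rw [indicator_of_notMem h]; simp

/-- Points of the circle outside the larger arc `upperArc (m / 2)` are at distance at least `m / 2`
from `t`, so there the bound on `w` replaces Hölder continuity. Hence `w` has to agree with `u` on
the arc only. -/
lemma BoundedHolderOn.holderOnArc {u w : ℂ → ℝ} (hu : BoundedHolderOn u arc) (h : EqOn w u arc)
    {M : ℝ} (hw : IsDensity w M) : HolderOnArc w := by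
  intro m hm
  obtain ⟨C, r, hr, hr1, hK⟩ := hu.1 _ (upperArc_subset (half_pos hm)) (isCompact_upperArc (m / 2))
  have hM := hw.nonneg
  refine ⟨C + 2 * M * ((m / 2) ^ (r : ℝ))⁻¹, r, by positivity, by exact_mod_cast hr,
    by exact_mod_cast hr1, fun t ht htm ζ hζ => ?_⟩
  have hζ1 : ‖ζ‖ = 1 := by simpa using hζ
  have htK : t ∈ upperArc (m / 2) := ⟨ht, by linarith⟩
  rcases le_or_gt (m / 2) ζ.im with hi | hi
  · have hζK : ζ ∈ upperArc (m / 2) := ⟨hζ1, hi⟩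
    have h1 := HolderOnWith.norm_sub_le hK hζK htK
    rw [h (upperArc_subset (half_pos hm) hζK), h (upperArc_subset (half_pos hm) htK)]
    rw [Real.norm_eq_abs] at h1
    refine h1.trans ?_
    gcongr
    have : 0 ≤ 2 * M * ((m / 2) ^ (r : ℝ))⁻¹ := by positivity
    linarith
  · have h1 : m / 2 ≤ ‖ζ - t‖ := by
      have := Complex.abs_im_le_norm (ζ - t)
      rw [Complex.sub_im] at this
      linarith [neg_abs_le (ζ.im - t.im)]
    have h2 : |w ζ - w t| ≤ 2 * M := by
      have := abs_sub (w ζ) (w t)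
      linarith [hw.bound ζ hζ, hw.bound t (by simpa using ht)]
    have h3 : (m / 2) ^ (r : ℝ) ≤ ‖ζ - t‖ ^ (r : ℝ) := by gcongr
    have hp : 0 < (m / 2) ^ (r : ℝ) := by positivity
    calc |w ζ - w t| ≤ 2 * M * (((m / 2) ^ (r : ℝ))⁻¹ * (m / 2) ^ (r : ℝ)) := by
          rw [inv_mul_cancel₀ hp.ne', mul_one]; exact h2
      _ ≤ 2 * M * (((m / 2) ^ (r : ℝ))⁻¹ * ‖ζ - t‖ ^ (r : ℝ)) := by gcongr
      _ ≤ _ := by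
        have : 0 ≤ (C : ℝ) * ‖ζ - t‖ ^ (r : ℝ) := by positivity
        nlinarith

lemma boundedHolderOn_zero (S : Set ℂ) : BoundedHolderOn (fun _ => (0 : ℝ)) S :=
  ⟨fun _ _ _ => ⟨0, 1, one_pos, le_rfl, fun _ _ _ _ => by simp⟩, 0, fun _ _ => by simp⟩

/-! ### Reflection, and the Cauchy-type integrals as Schwarz integrals -/

/-- The extension by zero of a function on `L` to the circle. -/
abbrev upperDensity (u : ℂ → ℝ) : ℂ → ℝ := arc.indicator u

/-- The reflection of `upperDensity u` in the real axis. -/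
def lowerDensity (u : ℂ → ℝ) (ζ : ℂ) : ℝ := arc.indicator u (starRingEnd ℂ ζ)

lemma lowerDensity_of_im_nonneg {u : ℂ → ℝ} {ζ : ℂ} (h : 0 ≤ ζ.im) : lowerDensity u ζ = 0 :=
  indicator_of_notMem (fun h' => by have := h'.2; simp at this; linarith) _

lemma isDensity_lowerDensity {u : ℂ → ℝ} {M : ℝ} (h : IsDensity (upperDensity u) M) :
    IsDensity (lowerDensity u) M := by
  refine ⟨?_, fun ζ hζ => h.bound _ (by simpa using hζ)⟩
  have h1 : (fun θ : ℝ => lowerDensity u (circleMap 0 1 θ)) =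
      (fun θ : ℝ => upperDensity u (circleMap 0 1 θ)) ∘ fun θ => -θ := by
    ext θ
    simp only [lowerDensity, Function.comp_apply, circleMap]
    congr 1
    simp [← Complex.exp_conj]
  rw [h1]
  exact h.meas.comp_quasiMeasurePreserving
    (Measure.measurePreserving_neg volume).quasiMeasurePreserving

lemma conj_herglotzRieszKernel (z ζ : ℂ) :
    starRingEnd ℂ (herglotzRieszKernel 0 z ζ) =
      herglotzRieszKernel 0 (starRingEnd ℂ z) (starRingEnd ℂ ζ) := by
  simp [herglotzRieszKernel_def]

lemma schwarz_lowerDensity {u : ℂ → ℝ} {M : ℝ} (h : IsDensity (upperDensity u) M) {z : ℂ}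
    (hz : ‖z‖ < 1) :
    schwarz (lowerDensity u) z = starRingEnd ℂ (schwarz (upperDensity u) (starRingEnd ℂ z)) := by
  unfold schwarz
  rw [← conj_circleAverage (h.circleIntegrable_kernel (by simpa using hz)),
    ← circleAverage_comp_conj]
  congr 1
  ext ζ
  simp [lowerDensity, conj_herglotzRieszKernel]

lemma integral_eq_circleAverage_of_subset {f : ℂ → ℂ} {s : Set ℝ} (hs : s ⊆ Ioc 0 (2 * π))
    (h : ∀ θ ∈ Ioc 0 (2 * π) \ s, f (circlePt θ) = 0) :
    ∫ θ in s, f (circlePt θ) = 2 * π * Real.circleAverage f 0 1 := by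
  rw [Real.circleAverage_def, intervalIntegral.integral_of_le (by positivity),
    ← setIntegral_eq_of_subset_of_forall_sdiff_eq_zero measurableSet_Ioc hs h]
  simp_rw [circlePt_eq_circleMap, Complex.real_smul]
  have := Real.pi_ne_zero
  push_cast
  field_simp

lemma circlePt_mem_arc_iff {θ : ℝ} (hθ : θ ∈ Ioc 0 (2 * π)) : circlePt θ ∈ arc ↔ θ ∈ Ioo 0 π := by
  refine ⟨fun h => ⟨hθ.1, ?_⟩, circlePt_mem_arc⟩
  by_contra! hc
  have h1 : 0 < Real.sin θ := by rw [← circlePt_im]; exact h.2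
  have h2 : Real.sin (θ - π) = - Real.sin θ := Real.sin_sub_pi θ
  have := Real.sin_nonneg_of_nonneg_of_le_pi (x := θ - π) (by linarith) (by linarith [hθ.2])
  linarith

lemma Ioo_subset_period : Ioo 0 π ⊆ Ioc 0 (2 * π) := fun θ hθ =>
  ⟨hθ.1, by linarith [hθ.2, Real.pi_pos]⟩

/-- Passing from `z` to `-z` lowers the argument by `π` in the upper half-plane. With this constant
value the coefficients in the Cauchy-type integrals collapse to `0`, `1 - β` and to `1`, `-β`. -/
lemma gam_of_im_pos (β : ℝ) {z : ℂ} (hz : 0 < z.im) : gam β z = β / 2 := by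
  have hz0 : z ≠ 0 := by rintro rfl; simp at hz
  have : Complex.log z - Complex.log (-z) = π * I := by
    rw [Complex.log, Complex.log, norm_neg, Complex.arg_neg_eq_arg_sub_pi_of_im_pos hz]
    push_cast; ring
  rw [gam, this]
  have := Real.pi_ne_zero
  have h2 : (π : ℂ) ≠ 0 := by exact_mod_cast this
  field_simp

/-- This identifies the second kernel of the integral equation as the Schwarz kernel with its pole
variable reflected, as `τ⁻¹` is the conjugate of `τ`. -/
lemma herglotzRieszKernel_conj_right {z τ : ℂ} (hτ : ‖τ‖ = 1) :
    herglotzRieszKernel 0 z (starRingEnd ℂ τ) = (1 + τ * z) / (1 - τ * z) := by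
  have hτ0 : τ ≠ 0 := norm_ne_zero_iff.1 (by rw [hτ]; exact one_ne_zero)
  rw [← inv_eq_conj hτ, herglotzRieszKernel_def, sub_zero, sub_zero,
    ← mul_div_mul_left _ _ hτ0, mul_add, mul_sub, mul_inv_cancel₀ hτ0]

lemma circleIntegrable_kernel_conj {u : ℂ → ℝ} {M : ℝ} (h : IsDensity (upperDensity u) M) {z : ℂ}
    (hz : ‖z‖ < 1) :
    CircleIntegrable
      (fun ζ => herglotzRieszKernel 0 z (starRingEnd ℂ ζ) • (upperDensity u ζ : ℂ)) 0 1 := by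
  have hc : ContinuousOn (fun ζ => herglotzRieszKernel 0 z (starRingEnd ℂ ζ))
      (sphere (0 : ℂ) |1|) :=
    ContinuousOn.comp (continuousOn_herglotzRieszKernel_sphere (by simpa using hz))
      Complex.continuous_conj.continuousOn fun ζ hζ => by simpa using hζ
  exact h.circleIntegrable.continuousOn_smul hc

lemma schwarz_lowerDensity_eq {u : ℂ → ℝ} (z : ℂ) :
    schwarz (lowerDensity u) z = Real.circleAverage
      (fun ζ => herglotzRieszKernel 0 z (starRingEnd ℂ ζ) • (upperDensity u ζ : ℂ)) 0 1 := by
  rw [← circleAverage_comp_conj]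
  simp [schwarz, lowerDensity]

lemma arcIntegral_eq_circleAverage {F : ℂ → ℂ} {g : ℂ → ℂ} {u : ℂ → ℝ}
    (h : ∀ τ ∈ arc, g τ = F τ * u τ / τ) :
    arcIntegral g = 2 * π * I * Real.circleAverage (fun ζ => F ζ • (upperDensity u ζ : ℂ)) 0 1 := by
  have h1 := integral_eq_circleAverage_of_subset
    (f := fun ζ => I * (F ζ • (upperDensity u ζ : ℂ))) Ioo_subset_period (fun θ hθ => by
      have : circlePt θ ∉ arc := fun h' => hθ.2 ((circlePt_mem_arc_iff hθ.1).1 h')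
      simp [upperDensity, this])
  have h2 : Real.circleAverage (fun ζ => I * (F ζ • (upperDensity u ζ : ℂ))) 0 1 =
      I * Real.circleAverage (fun ζ => F ζ • (upperDensity u ζ : ℂ)) 0 1 := by
    rw [← smul_eq_mul, ← Real.circleAverage_fun_smul]; rfl
  rw [h2, ← mul_assoc] at h1
  rw [arcIntegral, ← h1]
  refine setIntegral_congr_fun measurableSet_Ioo fun θ hθ => ?_
  have hm := circlePt_mem_arc hθ
  have h0 : circlePt θ ≠ 0 := norm_ne_zero_iff.1 (by rw [norm_circlePt]; exact one_ne_zero)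
  simp only [arcIntegrand, h _ hm, upperDensity, indicator_of_mem hm, smul_eq_mul]
  field_simp

lemma cauchy₁_eq_schwarz {β : ℝ} {u : ℂ → ℝ} {z : ℂ} (hz : z ∈ halfDisc) :
    cauchy₁ β u z = schwarz (fun ζ => (1 - β) * lowerDensity u ζ) z := by
  rw [cauchy₁, arcIntegral_eq_circleAverage
    (F := fun τ => (1 - β : ℂ) • herglotzRieszKernel 0 z (starRingEnd ℂ τ)) (u := u) (fun τ hτ => by
      rw [gam_of_im_pos β hz.2, gam_of_im_pos β hτ.2, smul_eq_mul,
        herglotzRieszKernel_conj_right hτ.1]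
      ring)]
  simp_rw [smul_assoc]
  rw [Real.circleAverage_fun_smul, ← schwarz_lowerDensity_eq, schwarz_const_mul]
  have := Real.pi_ne_zero
  have h2 : (π : ℂ) ≠ 0 := by exact_mod_cast this
  push_cast
  simp only [smul_eq_mul]
  field_simp

lemma cauchy₂_eq_schwarz {β : ℝ} {u : ℂ → ℝ} {M : ℝ} (h : IsDensity (upperDensity u) M) {z : ℂ}
    (hz : z ∈ halfDisc) :
    cauchy₂ β u z = schwarz (fun ζ => upperDensity u ζ + -β * lowerDensity u ζ) z := by
  rw [cauchy₂, arcIntegral_eq_circleAverage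
    (F := fun τ => herglotzRieszKernel 0 z τ +
      (-β : ℂ) • herglotzRieszKernel 0 z (starRingEnd ℂ τ)) (u := u) (fun τ hτ => by
      rw [gam_of_im_pos β hz.2, gam_of_im_pos β hτ.2, smul_eq_mul,
        herglotzRieszKernel_conj_right hτ.1, herglotzRieszKernel_def, sub_zero, sub_zero]
      ring),
    schwarz_add h ((isDensity_lowerDensity h).const_mul (-β)) hz.1, schwarz_const_mul]
  have hi : CircleIntegrable (fun ζ => (-β : ℂ) • herglotzRieszKernel 0 z (starRingEnd ℂ ζ) •
      (upperDensity u ζ : ℂ)) 0 1 := (circleIntegrable_kernel_conj h hz.1).const_smul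
  simp_rw [add_smul, smul_assoc]
  rw [Real.circleAverage_fun_add (h.circleIntegrable_kernel hz.1) hi, Real.circleAverage_fun_smul,
    ← schwarz_lowerDensity_eq, ← schwarz]
  have := Real.pi_ne_zero
  have h2 : (π : ℂ) ≠ 0 := by exact_mod_cast this
  push_cast
  simp only [smul_eq_mul]
  field_simp

/-! ### The principal value in the integral equation -/

/-- The reflected point lies below the real axis, hence at distance at least `t.im` from `t`: this
part of the kernel is not singular on the arc. -/
lemma norm_herglotzRieszKernel_conj_le {t ζ : ℂ} (ht : t ∈ arc) (hζ : ζ ∈ arc) :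
    ‖herglotzRieszKernel 0 t (starRingEnd ℂ ζ)‖ ≤ 2 / t.im := by
  have h1 : t.im ≤ ‖starRingEnd ℂ ζ - t‖ := by
    have := Complex.abs_im_le_norm (starRingEnd ℂ ζ - t)
    rw [Complex.sub_im, Complex.conj_im] at this
    linarith [neg_abs_le (-ζ.im - t.im), hζ.2]
  have h2 : ‖starRingEnd ℂ ζ + t‖ ≤ 2 := by
    refine (norm_add_le _ _).trans ?_
    rw [Complex.norm_conj, hζ.1, ht.1]; norm_num
  rw [herglotzRieszKernel_def, sub_zero, sub_zero, norm_div]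
  exact div_le_div₀ zero_le_two h2 ht.2 h1

/-- The nonsingular part of the kernel of the integral equation, cut off near `t`. -/
def truncReflKernel (t : ℂ) (ε : ℝ) (ζ : ℂ) : ℂ :=
  if ε < ‖ζ - t‖ then herglotzRieszKernel 0 t (starRingEnd ℂ ζ) else 0

lemma norm_truncReflKernel_smul_le {u : ℂ → ℝ} {M : ℝ} (h : IsDensity (upperDensity u) M) {t : ℂ}
    (ht : t ∈ arc) (ε : ℝ) {ζ : ℂ} (hζ : ζ ∈ sphere (0 : ℂ) 1) :
    ‖truncReflKernel t ε ζ • (upperDensity u ζ : ℂ)‖ ≤ 2 / t.im * M := by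
  have hM := h.nonneg
  have him := ht.2
  have h0 : 0 ≤ 2 / t.im * M := by positivity
  by_cases hm : ζ ∈ arc
  · rw [norm_smul, Complex.norm_real, Real.norm_eq_abs]
    refine mul_le_mul ?_ (h.bound ζ hζ) (abs_nonneg _) (by positivity)
    unfold truncReflKernel
    split_ifs
    · exact norm_herglotzRieszKernel_conj_le ht hm
    · simp; positivity
  · simpa [upperDensity, hm] using h0

lemma aestronglyMeasurable_truncReflKernel {u : ℂ → ℝ} {M : ℝ} (h : IsDensity (upperDensity u) M)
    (t : ℂ) (ε : ℝ) : AEStronglyMeasurable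
      (fun θ : ℝ => truncReflKernel t ε (circleMap 0 1 θ) •
        (upperDensity u (circleMap 0 1 θ) : ℂ)) volume := by
  have h1 : Measurable (truncReflKernel t ε) := by
    refine Measurable.ite (measurableSet_lt measurable_const (by fun_prop)) ?_ measurable_const
    simp only [herglotzRieszKernel_def, sub_zero]
    have : Measurable (starRingEnd ℂ : ℂ → ℂ) := Complex.continuous_conj.measurable
    exact (this.add_const t).div (this.sub_const t)
  exact (h1.comp (continuous_circleMap 0 1).measurable).aestronglyMeasurable.smul
      (Complex.continuous_ofReal.comp_aestronglyMeasurable h.meas)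

lemma circleIntegrable_truncReflKernel {u : ℂ → ℝ} {M : ℝ} (h : IsDensity (upperDensity u) M)
    {t : ℂ} (ht : t ∈ arc) (ε : ℝ) :
    CircleIntegrable (fun ζ => truncReflKernel t ε ζ • (upperDensity u ζ : ℂ)) 0 1 :=
  intervalIntegrable_of_norm_le (aestronglyMeasurable_truncReflKernel h t ε)
    fun θ => norm_truncReflKernel_smul_le h ht ε (circleMap_mem_unit θ)

lemma holderOnArc_upperDensity {u : ℂ → ℝ} (hu : BoundedHolderOn u arc) {M : ℝ}
    (h : IsDensity (upperDensity u) M) : HolderOnArc (upperDensity u) :=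
  hu.holderOnArc (fun _ hz => indicator_of_mem hz u) h

lemma holderOnArc_lowerDensity {u : ℂ → ℝ} {M : ℝ} (h : IsDensity (upperDensity u) M) :
    HolderOnArc (lowerDensity u) :=
  (boundedHolderOn_zero arc).holderOnArc
    (fun _ hz => lowerDensity_of_im_nonneg (le_of_lt hz.2)) (isDensity_lowerDensity h)

/-- On the arc the Schwarz integral of the reflected density is an ordinary integral. -/
lemma schwarzExt_lowerDensity {u : ℂ → ℝ} {M : ℝ} (h : IsDensity (upperDensity u) M) {t : ℂ}
    (ht : t ∈ arc) : schwarzExt (lowerDensity u) t = Real.circleAverage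
      (fun ζ => herglotzRieszKernel 0 t (starRingEnd ℂ ζ) • (upperDensity u ζ : ℂ)) 0 1 := by
  have h1 := tendsto_truncated (isDensity_lowerDensity h) (holderOnArc_lowerDensity h) ht
  rw [lowerDensity_of_im_nonneg (le_of_lt ht.2), Complex.ofReal_zero, sub_zero] at h1
  refine tendsto_nhds_unique h1 (tendsto_const_nhds.congr' ?_)
  -- For `ε < t.im` the cutoff does not reach the reflected arc, so the truncated averages are
  -- constant in `ε`.
  filter_upwards [Ioo_mem_nhdsGT ht.2] with ε hε
  rw [← circleAverage_comp_conj (fun ζ => truncKernel t ε ζ • (lowerDensity u ζ : ℂ))]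
  congr 1
  ext ζ
  by_cases hm : ζ ∈ arc
  · have h2 : ε < ‖starRingEnd ℂ ζ - t‖ := by
      have := Complex.abs_im_le_norm (starRingEnd ℂ ζ - t)
      rw [Complex.sub_im, Complex.conj_im] at this
      linarith [neg_abs_le (-ζ.im - t.im), hm.2, hε.2]
    simp [truncKernel, h2, lowerDensity]
  · simp [lowerDensity, upperDensity, hm]

/-- Dominated convergence: the integrands are bounded by `2 / t.im * M`, and removing the cutoff
changes nothing in the limit except at `t` itself. -/
lemma tendsto_truncReflKernel {u : ℂ → ℝ} {M : ℝ} (h : IsDensity (upperDensity u) M) {t : ℂ}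
    (ht : t ∈ arc) :
    Tendsto (fun ε : ℝ =>
      Real.circleAverage (fun ζ => truncReflKernel t ε ζ • (upperDensity u ζ : ℂ)) 0 1)
      (𝓝[>] 0) (𝓝 (schwarzExt (lowerDensity u) t)) := by
  rw [schwarzExt_lowerDensity h ht]
  refine Tendsto.const_smul ?_ _
  refine intervalIntegral.tendsto_integral_filter_of_dominated_convergence
    (fun _ => 2 / t.im * M) ?_ ?_ intervalIntegrable_const ?_
  · exact Eventually.of_forall fun ε => (aestronglyMeasurable_truncReflKernel h t ε).restrict
  · exact Eventually.of_forall fun ε => ae_of_all _ fun θ _ =>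
      norm_truncReflKernel_smul_le h ht ε (circleMap_mem_unit θ)
  · have hc := ((countable_singleton t).preimage_circleMap 0 one_ne_zero).measure_zero volume
    filter_upwards [compl_mem_ae_iff.2 hc] with θ hθ _
    have hne : 0 < ‖circleMap 0 1 θ - t‖ := norm_pos_iff.2 (sub_ne_zero.2 hθ)
    refine tendsto_const_nhds.congr' ?_
    filter_upwards [Ioo_mem_nhdsGT hne] with ε hε
    simp [truncReflKernel, hε.2]

/-- Existence and value of the principal value integral in the singular integral equation. -/
lemma hasArcPV {β : ℝ} {u : ℂ → ℝ} (hu : BoundedHolderOn u arc) {M : ℝ}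
    (h : IsDensity (upperDensity u) M) {t : ℂ} (ht : t ∈ arc) :
    HasArcPV (fun τ => ((τ + t) / (τ - t) - β * (1 + τ * t) / (1 - τ * t)) * u τ / τ) t
      (2 * π * I * (schwarzExt (upperDensity u) t - u t -
        β * schwarzExt (lowerDensity u) t)) := by
  -- The principal value truncates the whole integrand around `t`, so the regular kernel carries the
  -- same cutoff as the singular one.
  set F : ℝ → ℂ → ℂ := fun ε ζ => I * (truncKernel t ε ζ • (upperDensity u ζ : ℂ) -
    (β : ℂ) • (truncReflKernel t ε ζ • (upperDensity u ζ : ℂ))) with hF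
  have hsub : ∀ ε, truncatedArc t ε ⊆ Ioc 0 (2 * π) := fun ε θ hθ => Ioo_subset_period hθ.1
  have hmeas : ∀ ε, MeasurableSet (truncatedArc t ε) := fun ε =>
    measurableSet_Ioo.inter (isOpen_lt continuous_const
      (continuous_circlePt.sub continuous_const).norm).measurableSet
  have heq : ∀ ε, EqOn (fun θ => F ε (circlePt θ)) (arcIntegrand
      (fun τ => ((τ + t) / (τ - t) - β * (1 + τ * t) / (1 - τ * t)) * u τ / τ))
      (truncatedArc t ε) := by
    intro ε θ hθ
    have hm := circlePt_mem_arc hθ.1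
    have h0 : circlePt θ ≠ 0 := norm_ne_zero_iff.1 (by rw [norm_circlePt]; exact one_ne_zero)
    simp only [hF, arcIntegrand, upperDensity, indicator_of_mem hm, truncKernel, truncReflKernel,
      if_pos hθ.2, herglotzRieszKernel_conj_right (norm_circlePt θ), smul_eq_mul]
    have hcancel : ∀ a : ℂ, a / circlePt θ * (I * circlePt θ) = I * a := fun a => by field_simp
    rw [herglotzRieszKernel_def, sub_zero, sub_zero, hcancel]
    ring
  have hzero : ∀ ε, ∀ θ ∈ Ioc 0 (2 * π) \ truncatedArc t ε, F ε (circlePt θ) = 0 := by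
    intro ε θ hθ
    by_cases hm : circlePt θ ∈ arc
    · have h1 : ¬ ε < ‖circlePt θ - t‖ := fun h' =>
        hθ.2 ⟨(circlePt_mem_arc_iff hθ.1).1 hm, h'⟩
      simp [hF, truncKernel, truncReflKernel, h1]
    · simp [hF, upperDensity, hm]
  have hi : ∀ ε, 0 < ε → CircleIntegrable (fun ζ => truncKernel t ε ζ • (upperDensity u ζ : ℂ)) 0 1 :=
    fun ε hε => h.circleIntegrable_truncKernel ht.1 hε
  have hi' : ∀ ε, CircleIntegrable
      (fun ζ => (β : ℂ) • (truncReflKernel t ε ζ • (upperDensity u ζ : ℂ))) 0 1 :=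
    fun ε => (circleIntegrable_truncReflKernel h ht ε).const_smul
  refine ⟨fun ε hε => ?_, ?_⟩
  · have h1 : CircleIntegrable (F ε) 0 1 := ((hi ε hε).sub (hi' ε)).const_smul (a := I)
    have h2 : IntegrableOn (fun θ => F ε (circlePt θ)) (Ioc 0 (2 * π)) := by
      have := (intervalIntegrable_iff_integrableOn_Ioc_of_le (by positivity)).1 h1
      simpa only [circlePt_eq_circleMap] using this
    exact (h2.mono_set (hsub ε)).congr_fun (heq ε) (hmeas ε)
  · have h1 : Tendsto (fun ε : ℝ => 2 * π * I *
        (Real.circleAverage (fun ζ => truncKernel t ε ζ • (upperDensity u ζ : ℂ)) 0 1 -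
        β * Real.circleAverage (fun ζ => truncReflKernel t ε ζ • (upperDensity u ζ : ℂ)) 0 1))
        (𝓝[>] 0) (𝓝 (2 * π * I * (schwarzExt (upperDensity u) t - u t -
        β * schwarzExt (lowerDensity u) t))) := by
      have h2 := tendsto_truncated h (holderOnArc_upperDensity hu h) ht
      rw [upperDensity, indicator_of_mem ht] at h2
      exact (h2.sub ((tendsto_truncReflKernel h ht).const_mul (β : ℂ))).const_mul _
    refine h1.congr' ?_
    filter_upwards [self_mem_nhdsWithin] with ε hε
    rw [← setIntegral_congr_fun (hmeas ε) (heq ε),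
      integral_eq_circleAverage_of_subset (hsub ε) (hzero ε)]
    have h2 : Real.circleAverage (F ε) 0 1 = I • Real.circleAverage
        (fun ζ => truncKernel t ε ζ • (upperDensity u ζ : ℂ) -
          (β : ℂ) • (truncReflKernel t ε ζ • (upperDensity u ζ : ℂ))) 0 1 := by
      rw [← Real.circleAverage_fun_smul]; rfl
    rw [h2, Real.circleAverage_fun_sub (hi ε hε) (hi' ε), Real.circleAverage_fun_smul]
    simp only [smul_eq_mul]
    ring

/-! ### The reflected Schwarz integral near the diameter -/

/-- The density lives on the lower half-circle, where `‖ζ - z‖ ≥ z.im` and therefore `‖ζ - x‖ ≤ 3 *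
‖ζ - z‖`. The kernel difference times the density is then at most `12 * z.im * M * ‖ζ - x‖⁻²`, and
the average of `‖ζ - x‖⁻²` is at most `2 / z.im`. -/
lemma norm_schwarz_lowerDensity_sub_le {u : ℂ → ℝ} {M : ℝ} (h : IsDensity (upperDensity u) M)
    {z x : ℂ} (hz : ‖z‖ < 1) (hx : ‖x‖ < 1) (him : 0 < z.im) (h1 : ‖z - x‖ ≤ 2 * z.im)
    (h2 : z.im / 2 ≤ 1 - ‖x‖) :
    ‖schwarz (lowerDensity u) z - schwarz (lowerDensity u) x‖ ≤ 24 * M := by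
  have hl := isDensity_lowerDensity h
  have hM := h.nonneg
  unfold schwarz
  rw [← Real.circleAverage_fun_sub (hl.circleIntegrable_kernel hz) (hl.circleIntegrable_kernel hx)]
  have hb := norm_circleAverage_le_inv_sq (f := fun ζ =>
      herglotzRieszKernel 0 z ζ • (lowerDensity u ζ : ℂ) -
        herglotzRieszKernel 0 x ζ • (lowerDensity u ζ : ℂ)) hx (A := 12 * z.im * M) (B := 0)
    (fun ζ hζ => by
      rw [add_zero]
      rcases le_or_gt 0 ζ.im with hi | hi
      · rw [lowerDensity_of_im_nonneg hi]; simp; positivity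
      have hz0 := norm_pos_iff.2 (sub_ne_zero_of_mem hz hζ)
      have hx0 := norm_pos_iff.2 (sub_ne_zero_of_mem hx hζ)
      rw [← sub_smul, herglotzRieszKernel_sub (norm_pos_iff.1 hz0) (norm_pos_iff.1 hx0),
        norm_smul, norm_div, norm_mul, norm_mul, norm_mul, mem_sphere_zero_iff_norm.1 hζ,
        Complex.norm_real, Real.norm_eq_abs, mul_one, Complex.norm_ofNat]
      have hq : z.im ≤ ‖ζ - z‖ := by
        have := Complex.abs_im_le_norm (ζ - z)
        rw [Complex.sub_im] at this
        linarith [neg_abs_le (ζ.im - z.im)]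
      have hxz : ‖ζ - x‖ ≤ 3 * ‖ζ - z‖ := by
        have := norm_add_le (ζ - z) (z - x)
        rw [sub_add_sub_cancel] at this
        linarith
      have hd : (‖ζ - z‖ * ‖ζ - x‖)⁻¹ ≤ 3 * (‖ζ - x‖ ^ 2)⁻¹ := by
        rw [← div_eq_mul_inv, inv_eq_one_div, div_le_div_iff₀ (by positivity) (by positivity)]
        nlinarith
      rw [div_eq_mul_inv]
      calc 2 * ‖z - x‖ * (‖ζ - z‖ * ‖ζ - x‖)⁻¹ * |lowerDensity u ζ|
          ≤ 2 * (2 * z.im) * (3 * (‖ζ - x‖ ^ 2)⁻¹) * M := by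
            gcongr
            exact hl.bound ζ hζ
        _ = _ := by ring)
  refine hb.trans ?_
  have h3 : (1 - ‖x‖ ^ 2)⁻¹ ≤ (z.im / 2)⁻¹ := by
    apply inv_anti₀ (by positivity)
    nlinarith [norm_nonneg x]
  calc 12 * z.im * M * (1 - ‖x‖ ^ 2)⁻¹ + 0 ≤ 12 * z.im * M * (z.im / 2)⁻¹ + 0 := by gcongr
    _ = _ := by field_simp; ring

/-- In the half-disc, the Schwarz integral of the reflected density stays within a bounded distance
of its values on the diameter. -/
lemma exists_real_norm_schwarz_lowerDensity_sub_le {u : ℂ → ℝ} {M : ℝ}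
    (h : IsDensity (upperDensity u) M) {z : ℂ} (hz : ‖z‖ < 1) (him : 0 ≤ z.im) :
    ∃ x : ℝ, |x| < 1 ∧
      ‖schwarz (lowerDensity u) z - schwarz (lowerDensity u) x‖ ≤ 24 * M := by
  have hM := h.nonneg
  have hre := (Complex.abs_re_le_norm z).trans_lt hz
  have himn := (Complex.abs_im_le_norm z).trans_lt hz
  rw [abs_of_nonneg him] at himn
  rcases him.eq_or_lt with h0 | h0
  · refine ⟨z.re, hre, ?_⟩
    have : ((z.re : ℝ) : ℂ) = z := Complex.ext (by simp) (by simp [← h0])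
    rw [this]; simp; positivity
  -- The real part alone could be too close to `±1`; a shift by `z.im / 2` in the direction of the
  -- origin gives the required margin.
  obtain ⟨x, hxz, hx⟩ : ∃ x : ℝ, |z.re - x| ≤ z.im / 2 ∧ z.im / 2 ≤ 1 - |x| := by
    have hre' := abs_lt.1 hre
    rcases le_total 0 z.re with hp | hp
    · refine ⟨z.re - z.im / 2, by rw [sub_sub_cancel, abs_of_pos (by positivity)], ?_⟩
      have : |z.re - z.im / 2| ≤ 1 - z.im / 2 := by rw [abs_le]; constructor <;> linarith
      linarith
    · refine ⟨z.re + z.im / 2, by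
        rw [sub_add_cancel_left, abs_neg, abs_of_pos (by positivity)], ?_⟩
      have : |z.re + z.im / 2| ≤ 1 - z.im / 2 := by rw [abs_le]; constructor <;> linarith
      linarith
  have hx1 : |x| < 1 := by linarith
  refine ⟨x, hx1, norm_schwarz_lowerDensity_sub_le h hz (by simpa using hx1) h0 ?_ (by simpa using hx)⟩
  have := Complex.norm_le_abs_re_add_abs_im (z - x)
  rw [Complex.sub_re, Complex.sub_im, Complex.ofReal_re, Complex.ofReal_im, sub_zero,
    abs_of_pos h0] at this
  linarith

/-! ### Linearity and regularity of the extended Schwarz integral -/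

lemma schwarzExt_add {v w : ℂ → ℝ} {M N : ℝ} (hv : IsDensity v M) (hw : IsDensity w N)
    (hvh : HolderOnArc v) (hwh : HolderOnArc w) (hh : HolderOnArc fun ζ => v ζ + w ζ) {z : ℂ}
    (hz : z ∈ closedHalfDisc) :
    schwarzExt (fun ζ => v ζ + w ζ) z = schwarzExt v z + schwarzExt w z := by
  obtain ⟨hc, hzc⟩ := mem_cutHalfDisc_of_mem hz
  refine tendsto_nhds_unique (tendsto_schwarz_radial (hv.add hw) hh hc hzc) ?_
  refine ((tendsto_schwarz_radial hv hvh hc hzc).add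
    (tendsto_schwarz_radial hw hwh hc hzc)).congr' ?_
  filter_upwards [Ioo_mem_nhdsLT_one] with r hr
  exact (schwarz_add hv hw (norm_ofReal_mul_lt hr.1 hr.2 hzc.1)).symm

lemma schwarzExt_const_mul {w : ℂ → ℝ} {M : ℝ} (hw : IsDensity w M) (hwh : HolderOnArc w) (a : ℝ)
    (hh : HolderOnArc fun ζ => a * w ζ) {z : ℂ} (hz : z ∈ closedHalfDisc) :
    schwarzExt (fun ζ => a * w ζ) z = a * schwarzExt w z := by
  obtain ⟨hc, hzc⟩ := mem_cutHalfDisc_of_mem hz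
  refine tendsto_nhds_unique (tendsto_schwarz_radial (hw.const_mul a) hh hc hzc) ?_
  refine ((tendsto_schwarz_radial hw hwh hc hzc).const_mul (a : ℂ)).congr fun r => ?_
  exact (schwarz_const_mul w a _).symm

lemma boundedHolderOn_schwarzExt {w : ℂ → ℝ} {M B : ℝ} (hw : IsDensity w M) (hh : HolderOnArc w)
    (hB : ∀ z : ℂ, ‖z‖ < 1 → 0 ≤ z.im → ‖schwarz w z‖ ≤ B) :
    BoundedHolderOn (schwarzExt w) closedHalfDisc := by
  refine ⟨fun K hKS hK => ?_, B, fun z hz => ?_⟩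
  · obtain ⟨c, hc, hKc⟩ := exists_subset_cutHalfDisc hKS hK
    obtain ⟨C, a, hC, ha, ha1, h⟩ := exists_holder_schwarzExt hw hh hc
    lift C to ℝ≥0 using hC
    lift a to ℝ≥0 using ha.le
    exact ⟨C, a, by exact_mod_cast ha, by exact_mod_cast ha1,
      holderOnWith_of_norm_sub_le fun p hp q hq => h p (hKc hp) q (hKc hq)⟩
  · obtain ⟨hc, hzc⟩ := mem_cutHalfDisc_of_mem hz
    refine le_of_tendsto (tendsto_schwarz_radial hw hh hc hzc).norm ?_
    filter_upwards [Ioo_mem_nhdsLT_one] with r hr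
    refine hB _ (norm_ofReal_mul_lt hr.1 hr.2 hzc.1) ?_
    rw [Complex.im_ofReal_mul]
    exact mul_nonneg hr.1.le hzc.2.1

lemma differentiableOn_schwarzExt {w : ℂ → ℝ} {M : ℝ} (hw : IsDensity w M) :
    DifferentiableOn ℂ (schwarzExt w) halfDisc := by
  have h1 : halfDisc ⊆ ball 0 1 := fun z hz => by simpa using hz.1
  exact ((differentiableOn_schwarz hw).mono h1).congr fun z hz => schwarzExt_of_norm_lt hz.1

lemma schwarz_zero_im {w : ℂ → ℝ} {M : ℝ} (hw : IsDensity w M) : (schwarz w 0).im = 0 := by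
  unfold schwarz
  have h1 := Complex.imCLM.circleAverage_comp_comm (hw.circleIntegrable_kernel (z := 0) (by simp))
  rw [imCLM_apply] at h1
  rw [← h1]
  have h2 : Real.circleAverage (imCLM ∘ fun ζ => herglotzRieszKernel 0 0 ζ • (w ζ : ℂ)) 0 1 =
      Real.circleAverage (fun _ => (0 : ℝ)) 0 1 := by
    refine Real.circleAverage_congr_sphere fun ζ hζ => ?_
    have h0 : ζ ≠ 0 := by
      rintro rfl; simp at hζ
    simp [herglotzRieszKernel_def, h0]
  rw [h2, Real.circleAverage_const]

/-! ### From a solution to a Hilbert pair -/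

section Densities

variable {β : ℝ} {u : ℂ → ℝ}

/-- The density of the first Cauchy-type integral. -/
def density₁ (β : ℝ) (u : ℂ → ℝ) (ζ : ℂ) : ℝ := (1 - β) * lowerDensity u ζ

/-- The density of the second Cauchy-type integral. -/
def density₂ (β : ℝ) (u : ℂ → ℝ) (ζ : ℂ) : ℝ := upperDensity u ζ + -β * lowerDensity u ζ

lemma isDensity₁ {M : ℝ} (h : IsDensity (upperDensity u) M) :
    IsDensity (density₁ β u) (|1 - β| * M) := (isDensity_lowerDensity h).const_mul _

lemma isDensity₂ {M : ℝ} (h : IsDensity (upperDensity u) M) :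
    IsDensity (density₂ β u) (M + |-β| * M) := h.add ((isDensity_lowerDensity h).const_mul _)

lemma density₁_of_mem_arc {t : ℂ} (ht : t ∈ arc) : density₁ β u t = 0 := by
  rw [density₁, lowerDensity_of_im_nonneg (le_of_lt ht.2), mul_zero]

lemma density₂_of_mem_arc {t : ℂ} (ht : t ∈ arc) : density₂ β u t = u t := by
  rw [density₂, lowerDensity_of_im_nonneg (le_of_lt ht.2), upperDensity, indicator_of_mem ht,
    mul_zero, add_zero]

lemma holderOnArc_density₁ {M : ℝ} (h : IsDensity (upperDensity u) M) :
    HolderOnArc (density₁ β u) :=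
  (boundedHolderOn_zero arc).holderOnArc (fun _ hz => density₁_of_mem_arc hz) (isDensity₁ h)

lemma holderOnArc_density₂ (hu : BoundedHolderOn u arc) {M : ℝ} (h : IsDensity (upperDensity u) M) :
    HolderOnArc (density₂ β u) :=
  hu.holderOnArc (fun _ hz => density₂_of_mem_arc hz) (isDensity₂ h)

lemma schwarz_density₁ (z : ℂ) :
    schwarz (density₁ β u) z = (1 - β) * schwarz (lowerDensity u) z := by
  have := schwarz_const_mul (lowerDensity u) (1 - β) z
  push_cast at this
  exact this

lemma schwarz_density₂ {M : ℝ} (h : IsDensity (upperDensity u) M) {z : ℂ} (hz : ‖z‖ < 1) :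
    schwarz (density₂ β u) z = schwarz (upperDensity u) z - β * schwarz (lowerDensity u) z := by
  have := schwarz_add h ((isDensity_lowerDensity h).const_mul (-β)) hz
  rw [schwarz_const_mul] at this
  push_cast at this
  rw [neg_mul, ← sub_eq_add_neg] at this
  exact this

lemma schwarzExt_density₂ (hu : BoundedHolderOn u arc) {M : ℝ} (h : IsDensity (upperDensity u) M)
    {z : ℂ} (hz : z ∈ closedHalfDisc) : schwarzExt (density₂ β u) z =
      schwarzExt (upperDensity u) z - β * schwarzExt (lowerDensity u) z := by
  have hl := isDensity_lowerDensity h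
  have hs : HolderOnArc fun ζ => -β * lowerDensity u ζ :=
    (boundedHolderOn_zero arc).holderOnArc (fun z hz => by
      rw [lowerDensity_of_im_nonneg (le_of_lt hz.2), mul_zero]) (hl.const_mul (-β))
  have h1 := schwarzExt_add h (hl.const_mul (-β)) (holderOnArc_upperDensity hu h) hs
    (holderOnArc_density₂ hu h) hz
  rw [schwarzExt_const_mul hl (holderOnArc_lowerDensity h) (-β) hs hz] at h1
  push_cast at h1
  rw [neg_mul, ← sub_eq_add_neg] at h1
  exact h1

/-- The principal value integral of the singular integral equation in terms of the boundary values
of the second Cauchy-type integral. -/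
lemma hasArcPV_density₂ (hu : BoundedHolderOn u arc) {t : ℂ} (ht : t ∈ arc) :
    HasArcPV (fun τ => ((τ + t) / (τ - t) - β * (1 + τ * t) / (1 - τ * t)) * u τ / τ) t
      (2 * π * I * (schwarzExt (density₂ β u) t - u t)) := by
  obtain ⟨M, h⟩ := hu.isDensity
  have h1 := hasArcPV (β := β) hu h ht
  rw [schwarzExt_density₂ hu h (arc_subset_closedHalfDisc ht)]
  convert h1 using 2
  ring

/-- Limits are unique, so the principal value in the equation is the one computed by the Plemelj
formula; the equation then reads `I * (boundary value - u t) = v t`. -/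
lemma schwarzExt_density₂_of_solves {v : ℂ → ℝ} (hu : BoundedHolderOn u arc)
    (hv : SolvesIntegralEquation β u v) {t : ℂ} (ht : t ∈ arc) :
    schwarzExt (density₂ β u) t = u t - I * v t := by
  obtain ⟨J, hJ, hJv⟩ := hv t ht
  have h1 := tendsto_nhds_unique hJ.2 (hasArcPV_density₂ (β := β) hu ht).2
  have h2 : (π : ℂ) ≠ 0 := by exact_mod_cast Real.pi_ne_zero
  rw [h1] at hJv
  have h3 : I * (schwarzExt (density₂ β u) t - u t) = v t := by
    rw [← hJv]; field_simp
  rw [← h3, ← mul_assoc, I_mul_I]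
  ring

lemma norm_le_of_abs_re_im {z : ℂ} {a b : ℝ} (h1 : |z.re| ≤ a) (h2 : |z.im| ≤ b) : ‖z‖ ≤ a + b :=
  (Complex.norm_le_abs_re_add_abs_im z).trans (add_le_add h1 h2)

lemma schwarz_lowerDensity_ofReal {M : ℝ} (h : IsDensity (upperDensity u) M) {x : ℝ}
    (hx : |x| < 1) :
    schwarz (lowerDensity u) x = starRingEnd ℂ (schwarz (upperDensity u) x) := by
  rw [schwarz_lowerDensity h (by simpa using hx), Complex.conj_ofReal]

/-- At a point of the diameter where `S = a + i b`, the second integral is `(1 - β) a + i (1 + β)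
b`. Dividing by both factors, which needs `β ≠ 1` and `β ≠ -1`, bounds `S` there, and the `24 * M`
comparison carries the bound into the half-disc. -/
lemma exists_bound_density₁ (hβ : β ≠ 1) (hβ' : β ≠ -1) {M : ℝ}
    (h : IsDensity (upperDensity u) M) {B : ℝ}
    (hB : ∀ z : ℂ, ‖z‖ < 1 → 0 ≤ z.im → ‖schwarz (density₂ β u) z‖ ≤ B) :
    ∃ B', ∀ z : ℂ, ‖z‖ < 1 → 0 ≤ z.im → ‖schwarz (density₁ β u) z‖ ≤ B' := by
  have ha : 0 < |1 - β| := abs_pos.2 (sub_ne_zero.2 hβ.symm)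
  have hb : 0 < |1 + β| := abs_pos.2 (fun h => hβ' (by linarith))
  refine ⟨|1 - β| * (24 * M + (B / |1 - β| + B / |1 + β|)), fun z hz him => ?_⟩
  obtain ⟨x, hx, hxz⟩ := exists_real_norm_schwarz_lowerDensity_sub_le h hz him
  have hxn : ‖(x : ℂ)‖ < 1 := by simpa using hx
  have h1 := hB x hxn (by simp)
  rw [schwarz_density₂ h hxn, schwarz_lowerDensity_ofReal h hx] at h1
  have hS : ‖schwarz (lowerDensity u) x‖ ≤ B / |1 - β| + B / |1 + β| := by
    rw [schwarz_lowerDensity_ofReal h hx, Complex.norm_conj]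
    apply norm_le_of_abs_re_im
    · rw [le_div_iff₀ ha, ← abs_mul,
        show (schwarz (upperDensity u) x).re * (1 - β) = (schwarz (upperDensity u) x -
          β * starRingEnd ℂ (schwarz (upperDensity u) x)).re by simp; ring]
      exact (Complex.abs_re_le_norm _).trans h1
    · rw [le_div_iff₀ hb, ← abs_mul,
        show (schwarz (upperDensity u) x).im * (1 + β) = (schwarz (upperDensity u) x -
          β * starRingEnd ℂ (schwarz (upperDensity u) x)).im by simp; ring]
      exact (Complex.abs_im_le_norm _).trans h1
  rw [schwarz_density₁, norm_mul, ← Complex.ofReal_one, ← Complex.ofReal_sub, Complex.norm_real,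
    Real.norm_eq_abs]
  gcongr
  have := norm_add_le (schwarz (lowerDensity u) z - schwarz (lowerDensity u) x)
    (schwarz (lowerDensity u) x)
  rw [sub_add_cancel] at this
  linarith

/-- On the diameter, with `S = a + i b`, the pair is `(1 - β) (a - i b)` and `(1 - β) a + i (1 + β)
b`, from which both diameter conditions are read off. The two functions agree at `0` because `S 0`
is real. -/
lemma isHilbertPair_schwarzExt (hβ : β ≠ 1) (hu : BoundedHolderOn u arc) {M : ℝ}
    (h : IsDensity (upperDensity u) M) {B₁ B₂ : ℝ}
    (hB₁ : ∀ z : ℂ, ‖z‖ < 1 → 0 ≤ z.im → ‖schwarz (density₁ β u) z‖ ≤ B₁)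
    (hB₂ : ∀ z : ℂ, ‖z‖ < 1 → 0 ≤ z.im → ‖schwarz (density₂ β u) z‖ ≤ B₂) :
    IsHilbertPair β (schwarzExt (density₁ β u)) (schwarzExt (density₂ β u)) where
  analytic₁ := differentiableOn_schwarzExt (isDensity₁ h)
  analytic₂ := differentiableOn_schwarzExt (isDensity₂ h)
  holder₁ := boundedHolderOn_schwarzExt (isDensity₁ h) (holderOnArc_density₁ h) hB₁
  holder₂ := boundedHolderOn_schwarzExt (isDensity₂ h) (holderOnArc_density₂ hu h) hB₂
  re_diameter x hx := by
    have hx1 : |x| < 1 := abs_lt.2 hx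
    have hxn : ‖(x : ℂ)‖ < 1 := by simpa using hx1
    rw [schwarzExt_of_norm_lt hxn, schwarzExt_of_norm_lt hxn, schwarz_density₁,
      schwarz_density₂ h hxn, schwarz_lowerDensity_ofReal h hx1]
    simp; ring
  im_diameter x hx := by
    have hx1 : |x| < 1 := abs_lt.2 hx
    have hxn : ‖(x : ℂ)‖ < 1 := by simpa using hx1
    have h1 : (1 - β) ≠ 0 := sub_ne_zero.2 hβ.symm
    have h2 : (((1 + β) / (1 - β) : ℝ) : ℂ) * (1 - β) = 1 + β := by
      have : ((1 + β) / (1 - β)) * (1 - β) = 1 + β := div_mul_cancel₀ _ h1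
      exact_mod_cast this
    rw [schwarzExt_of_norm_lt hxn, schwarzExt_of_norm_lt hxn, schwarz_density₁,
      schwarz_density₂ h hxn, schwarz_lowerDensity_ofReal h hx1, ← mul_assoc, h2]
    simp; ring
  re_arc t ht := by
    rw [re_schwarzExt_of_mem_arc (isDensity₁ h) (holderOnArc_density₁ h) ht,
      density₁_of_mem_arc ht]
  origin := by
    have h0 : ‖(0 : ℂ)‖ < 1 := by simp
    have h1 : ContinuousAt (fun z => schwarz (density₁ β u) z - schwarz (density₂ β u) z) 0 :=
      (hasDerivAt_schwarz (isDensity₁ h) h0).continuousAt.sub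
        (hasDerivAt_schwarz (isDensity₂ h) h0).continuousAt
    have h2 : schwarz (density₁ β u) 0 - schwarz (density₂ β u) 0 = 0 := by
      have h3 := schwarz_lowerDensity_ofReal h (x := 0) (by simp)
      have h4 : starRingEnd ℂ (schwarz (upperDensity u) 0) = schwarz (upperDensity u) 0 :=
        Complex.conj_eq_iff_im.2 (schwarz_zero_im h)
      rw [Complex.ofReal_zero, h4] at h3
      rw [schwarz_density₁, schwarz_density₂ h h0, h3]
      ring
    have h3 := h1.tendsto
    rw [h2] at h3
    refine (h3.mono_left nhdsWithin_le_nhds).congr' ?_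
    filter_upwards [self_mem_nhdsWithin] with z hz
    rw [schwarzExt_of_norm_lt hz.1, schwarzExt_of_norm_lt hz.1]

/-- A bounded solution of the integral equation yields a Hilbert pair. -/
theorem exists_isHilbertPair_of_solves (hβ : β ≠ 1) (hβ' : β ≠ -1) {v : ℂ → ℝ}
    (hu : BoundedHolderOn u arc) (hv : ∃ M : ℝ, ∀ t ∈ arc, |v t| ≤ M)
    (hs : SolvesIntegralEquation β u v) :
    ∃ Φ₁ Φ₂ : ℂ → ℂ, EqOn Φ₁ (cauchy₁ β u) halfDisc ∧ EqOn Φ₂ (cauchy₂ β u) halfDisc ∧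
      IsHilbertPair β Φ₁ Φ₂ ∧ (∀ t ∈ arc, (Φ₂ t).im = -v t) ∧ (∀ t ∈ arc, (Φ₂ t).re = u t) := by
  obtain ⟨M, h⟩ := hu.isDensity
  obtain ⟨V, hV⟩ := hv
  obtain ⟨B₂, hB₂⟩ := exists_norm_schwarz_le (isDensity₂ (β := β) h) (holderOnArc_density₂ hu h)
    (B := M + V) (fun t ht => by
      have hut : |u t| ≤ M := by
        have : |arc.indicator u t| ≤ M := h.bound t (by simpa using ht.1)
        rwa [indicator_of_mem ht] at this
      rw [schwarzExt_density₂_of_solves hu hs ht]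
      refine (norm_sub_le _ _).trans (add_le_add ?_ ?_)
      · simpa using hut
      · simpa using hV t ht)
  obtain ⟨B₁, hB₁⟩ := exists_bound_density₁ hβ hβ' h hB₂
  refine ⟨schwarzExt (density₁ β u), schwarzExt (density₂ β u), fun z hz => ?_, fun z hz => ?_,
    isHilbertPair_schwarzExt hβ hu h hB₁ hB₂, fun t ht => ?_, fun t ht => ?_⟩
  · rw [cauchy₁_eq_schwarz hz]; exact schwarzExt_of_norm_lt hz.1
  · rw [cauchy₂_eq_schwarz h hz]; exact schwarzExt_of_norm_lt hz.1
  · rw [schwarzExt_density₂_of_solves hu hs ht]; simp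
  · rw [schwarzExt_density₂_of_solves hu hs ht]; simp

end Densities

/-! ### Reflection across the diameter -/

/-- A continuous function on a disc that is holomorphic off the real axis is holomorphic. -/
lemma differentiableOn_of_differentiableAt_off_real {f : ℂ → ℂ} {c : ℂ} {r : ℝ}
    (hf : ContinuousOn f (ball c r))
    (hd : ∀ z ∈ ball c r, z.im ≠ 0 → DifferentiableAt ℂ f z) :
    DifferentiableOn ℂ f (ball c r) := by
  refine (isConservativeOn_and_continuousOn_iff_isDifferentiableOn isOpen_ball).1 ⟨?_, hf⟩
  intro z w hzw
  rw [← add_eq_zero_iff_eq_neg, wedgeIntegral_add_wedgeIntegral_eq]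
  -- Morera: Cauchy's theorem holds on rectangles whose interior misses the real axis, continuity
  -- sufficing on the boundary. A rectangle crossing the axis is cut along it into two such
  -- rectangles.
  have key : ∀ y₁ ∈ uIcc z.im w.im, ∀ y₂ ∈ uIcc z.im w.im,
      (0 : ℝ) ∉ Ioo (min y₁ y₂) (max y₁ y₂) →
      (∫ x : ℝ in z.re..w.re, f (x + y₁ * I)) - (∫ x : ℝ in z.re..w.re, f (x + y₂ * I)) +
        I • (∫ y : ℝ in y₁..y₂, f (w.re + y * I)) - I • (∫ y : ℝ in y₁..y₂, f (z.re + y * I)) = 0 := by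
    intro y₁ h₁ y₂ h₂ h0
    have hs : uIcc y₁ y₂ ⊆ uIcc z.im w.im := uIcc_subset_uIcc h₁ h₂
    have hsub : (uIcc z.re w.re) ×ℂ (uIcc y₁ y₂) ⊆ ball c r := fun p hp =>
      hzw ⟨hp.1, hs hp.2⟩
    have := integral_boundary_rect_eq_zero_of_continuousOn_of_differentiableOn f
      ⟨z.re, y₁⟩ ⟨w.re, y₂⟩ (hf.mono hsub) (fun p hp => by
        refine (hd p (hsub ⟨Ioo_subset_Icc_self hp.1, Ioo_subset_Icc_self hp.2⟩)
          fun him => h0 ?_).differentiableWithinAt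
        rw [← him]; exact hp.2)
    simpa using this
  by_cases h0 : (0 : ℝ) ∈ Ioo (min z.im w.im) (max z.im w.im)
  · have h0' : (0 : ℝ) ∈ uIcc z.im w.im := Ioo_subset_Icc_self h0
    have hv : ∀ a ∈ uIcc z.re w.re, ∀ y₁ ∈ uIcc z.im w.im, ∀ y₂ ∈ uIcc z.im w.im,
        IntervalIntegrable (fun y : ℝ => f (a + y * I)) volume y₁ y₂ := by
      intro a ha y₁ h₁ y₂ h₂
      refine (hf.comp (by fun_prop) fun y hy => hzw ?_).intervalIntegrable
      exact ⟨by simpa using ha, by simpa using uIcc_subset_uIcc h₁ h₂ hy⟩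
    have e1 := key _ left_mem_uIcc 0 h0' (by
      rintro ⟨h1, h2⟩; rcases le_total z.im 0 with h | h <;> simp_all)
    have e2 := key 0 h0' _ right_mem_uIcc (by
      rintro ⟨h1, h2⟩; rcases le_total 0 w.im with h | h <;> simp_all)
    rw [← intervalIntegral.integral_add_adjacent_intervals
        (hv _ right_mem_uIcc _ left_mem_uIcc 0 h0') (hv _ right_mem_uIcc 0 h0' _ right_mem_uIcc),
      ← intervalIntegral.integral_add_adjacent_intervals
        (hv _ left_mem_uIcc _ left_mem_uIcc 0 h0') (hv _ left_mem_uIcc 0 h0' _ right_mem_uIcc)]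
    have e3 := congrArg₂ (· + ·) e1 e2
    simp only [add_zero] at e3
    rw [← e3]
    simp only [smul_eq_mul]
    ring
  · exact key _ left_mem_uIcc _ right_mem_uIcc h0

/-- Two functions on the closed upper half of a disc glued along the real axis. -/
def reflectGlue (f g : ℂ → ℂ) (z : ℂ) : ℂ :=
  if 0 ≤ z.im then f z else starRingEnd ℂ (g (starRingEnd ℂ z))

lemma reflectGlue_of_im_nonpos {f g : ℂ → ℂ} (h : ∀ x : ℝ, |x| < 1 → f x = starRingEnd ℂ (g x))
    {z : ℂ} (hz : ‖z‖ < 1) (him : z.im ≤ 0) :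
    reflectGlue f g z = starRingEnd ℂ (g (starRingEnd ℂ z)) := by
  unfold reflectGlue
  split_ifs with h0
  · have h1 : ((z.re : ℝ) : ℂ) = z := Complex.ext (by simp) (by simp [le_antisymm him h0])
    have h2 := h z.re ((Complex.abs_re_le_norm z).trans_lt hz)
    rw [h1] at h2
    have h3 : starRingEnd ℂ z = z := Complex.conj_eq_iff_im.2 (le_antisymm him h0)
    rw [h2, h3]
  · rfl

/-- The Schwarz reflection principle for a pair of functions. -/
lemma differentiableOn_reflectGlue {f g : ℂ → ℂ} (hf : DifferentiableOn ℂ f halfDisc)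
    (hg : DifferentiableOn ℂ g halfDisc) (hfc : ContinuousOn f closedHalfDisc)
    (hgc : ContinuousOn g closedHalfDisc)
    (h : ∀ x : ℝ, |x| < 1 → f x = starRingEnd ℂ (g x)) :
    DifferentiableOn ℂ (reflectGlue f g) (ball 0 1) := by
  have hmem : ∀ z : ℂ, ‖z‖ < 1 → 0 ≤ z.im → z ∈ closedHalfDisc := fun z hz him =>
    mem_closedHalfDisc_iff.2 ⟨hz.le, him, (Complex.abs_re_le_norm z).trans_lt hz⟩
  have hopen : IsOpen halfDisc := (isOpen_lt continuous_norm continuous_const).inter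
    (isOpen_lt continuous_const Complex.continuous_im)
  apply differentiableOn_of_differentiableAt_off_real
  · have c1 : ContinuousOn (reflectGlue f g) (ball 0 1 ∩ {z | 0 ≤ z.im}) := by
      refine (hfc.mono fun z hz => hmem z (by simpa using hz.1) hz.2).congr fun z hz => ?_
      exact if_pos hz.2
    have c2 : ContinuousOn (reflectGlue f g) (ball 0 1 ∩ {z | z.im ≤ 0}) := by
      have : ContinuousOn (fun z => starRingEnd ℂ (g (starRingEnd ℂ z)))
          (ball 0 1 ∩ {z | z.im ≤ 0}) := by
        refine Complex.continuous_conj.comp_continuousOn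
          (hgc.comp Complex.continuous_conj.continuousOn fun z hz => ?_)
        refine hmem _ (by simpa using hz.1) ?_
        have := hz.2
        simpa using this
      exact this.congr fun z hz => reflectGlue_of_im_nonpos h (by simpa using hz.1) hz.2
    intro z hz
    have w1 : ContinuousWithinAt (reflectGlue f g) (ball 0 1 ∩ {z | 0 ≤ z.im}) z := by
      by_cases him : 0 ≤ z.im
      · exact c1 z ⟨hz, him⟩
      · refine continuousWithinAt_of_notMem_closure fun hcl => him ?_
        exact closure_minimal inter_subset_right
          (isClosed_le continuous_const Complex.continuous_im) hcl
    have w2 : ContinuousWithinAt (reflectGlue f g) (ball 0 1 ∩ {z | z.im ≤ 0}) z := by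
      by_cases him : z.im ≤ 0
      · exact c2 z ⟨hz, him⟩
      · refine continuousWithinAt_of_notMem_closure fun hcl => him ?_
        exact closure_minimal inter_subset_right
          (isClosed_le Complex.continuous_im continuous_const) hcl
    refine (w1.union w2).mono fun y hy => ?_
    rcases le_total 0 y.im with h1 | h1
    · exact Or.inl ⟨hy, h1⟩
    · exact Or.inr ⟨hy, h1⟩
  · intro z hz him
    have hzn : ‖z‖ < 1 := by simpa using hz
    rcases him.lt_or_gt with h1 | h1
    · have h2 : starRingEnd ℂ z ∈ halfDisc := ⟨by simpa using hzn, by simpa using h1⟩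
      have h3 := (hg.differentiableAt (hopen.mem_nhds h2)).conj_conj
      rw [Complex.conj_conj] at h3
      refine h3.congr_of_eventuallyEq ?_
      filter_upwards [(isOpen_lt Complex.continuous_im continuous_const).mem_nhds h1] with y hy
      exact if_neg (not_le.2 hy)
    · refine (hf.differentiableAt (hopen.mem_nhds ⟨hzn, h1⟩)).congr_of_eventuallyEq ?_
      filter_upwards [(isOpen_lt continuous_const Complex.continuous_im).mem_nhds h1] with y hy
      exact if_pos (le_of_lt hy)

/-! ### Poisson representation from radial limits -/

lemma eqOn_of_re_eq {F G : ℂ → ℂ} (hF : DifferentiableOn ℂ F (ball 0 1))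
    (hG : DifferentiableOn ℂ G (ball 0 1)) (h : ∀ z : ℂ, ‖z‖ < 1 → (F z).re = (G z).re)
    (h0 : (F 0).im = (G 0).im) : EqOn F G (ball 0 1) := by
  have hm : (0 : ℂ) ∈ ball (0 : ℂ) 1 := mem_ball_self one_pos
  obtain ⟨w, hw⟩ := ((hF.sub hG).analyticOnNhd isOpen_ball).eq_const_of_re_eq_const (c₀ := 0)
    (fun z hz => by simp [h z (by simpa using hz)]) isOpen_ball
    ((convex_ball (0 : ℂ) 1).isConnected ⟨0, hm⟩)
  intro z hz
  have h1 := hw z hz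
  rw [← hw 0 hm] at h1
  have h2 : F 0 = G 0 := Complex.ext (h 0 (by simp)) h0
  simp only [Pi.sub_apply, h2, sub_self] at h1
  exact sub_eq_zero.1 h1

/-- Poisson representation of a bounded holomorphic function by its radial boundary values. -/
lemma eqOn_schwarz_of_tendsto {G : ℂ → ℂ} {w : ℂ → ℝ} {M B : ℝ}
    (hG : DifferentiableOn ℂ G (ball 0 1)) (hw : IsDensity w M) (hB : ∀ z : ℂ, ‖z‖ < 1 → ‖G z‖ ≤ B)
    (hlim : ∀ ζ : ℂ, ‖ζ‖ = 1 → ζ.im ≠ 0 →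
      Tendsto (fun r : ℝ => (G (r * ζ)).re) (𝓝[<] 1) (𝓝 (w ζ)))
    (h0 : (G 0).im = 0) : EqOn G (schwarz w) (ball 0 1) := by
  refine eqOn_of_re_eq hG (differentiableOn_schwarz hw) (fun z hz => ?_)
    (by rw [h0, schwarz_zero_im hw])
  have hzb : z ∈ ball (0 : ℂ) 1 := by simpa using hz
  -- The dilate `ζ ↦ G (r * ζ)` is holomorphic on the closed disc, so the Poisson formula applies to
  -- it; then `r → 1` under dominated convergence.
  have hP : ∀ r : ℝ, r ∈ Ioo (0 : ℝ) 1 → (G (r * z)).re =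
      Real.circleAverage (fun ζ => (herglotzRieszKernel 0 z ζ).re * (G (r * ζ)).re) 0 1 := by
    intro r hr
    have hd : DifferentiableOn ℂ (fun ζ => G (r * ζ)) (closedBall 0 1) :=
      hG.comp (by fun_prop) fun ζ hζ => by
        simpa using norm_ofReal_mul_lt hr.1 hr.2 (by simpa using hζ)
    have hdc : DiffContOnCl ℂ (fun ζ => G (r * ζ)) (ball 0 1) :=
      (hd.mono closure_ball_subset_closedBall).diffContOnCl
    have h1 := hdc.circleAverage_re_herglotzRieszKernel_smul hzb
    have hc : CircleIntegrable ((re ∘ herglotzRieszKernel 0 z) • fun ζ => G (r * ζ)) 0 1 := by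
      refine ContinuousOn.circleIntegrable zero_le_one (ContinuousOn.smul ?_
        (hd.continuousOn.mono sphere_subset_closedBall))
      have := continuousOn_herglotzRieszKernel_sphere hzb
      rw [abs_one] at this
      exact Complex.continuous_re.comp_continuousOn this
    have h2 := Complex.reCLM.circleAverage_comp_comm hc
    rw [h1, reCLM_apply] at h2
    rw [← h2]
    congr 1
    ext ζ
    simp
  have hS : (schwarz w z).re =
      Real.circleAverage (fun ζ => (herglotzRieszKernel 0 z ζ).re * w ζ) 0 1 := by
    have h1 := Complex.reCLM.circleAverage_comp_comm (hw.circleIntegrable_kernel hz)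
    rw [reCLM_apply] at h1
    rw [schwarz, ← h1]
    congr 1
    ext ζ
    simp
  rw [hS]
  have hL : Tendsto (fun r : ℝ => (G (r * z)).re) (𝓝[<] 1) (𝓝 (G z).re) := by
    have h1 : ContinuousAt G z := (hG.differentiableAt (isOpen_ball.mem_nhds hzb)).continuousAt
    have h2 : Tendsto (fun r : ℝ => (r : ℂ) * z) (𝓝 1) (𝓝 z) := by
      have : Continuous fun r : ℝ => (r : ℂ) * z := by fun_prop
      simpa using this.tendsto 1
    exact ((Complex.continuous_re.tendsto _).comp (h1.tendsto.comp h2)).mono_left nhdsWithin_le_nhds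
  refine tendsto_nhds_unique hL (Tendsto.congr' ?_ (f₁ := fun r : ℝ =>
    Real.circleAverage (fun ζ => (herglotzRieszKernel 0 z ζ).re * (G (r * ζ)).re) 0 1) ?_)
  · filter_upwards [Ioo_mem_nhdsLT_one] with r hr using (hP r hr).symm
  have hKc : Continuous fun θ : ℝ => (herglotzRieszKernel 0 z (circleMap 0 1 θ)).re := by
    have := continuousOn_herglotzRieszKernel_sphere hzb
    rw [abs_one] at this
    exact Complex.continuous_re.comp
      (this.comp_continuous (continuous_circleMap 0 1) circleMap_mem_unit)
  refine Tendsto.const_smul ?_ _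
  refine intervalIntegral.tendsto_integral_filter_of_dominated_convergence
    (fun θ => ‖(herglotzRieszKernel 0 z (circleMap 0 1 θ)).re‖ * B) ?_ ?_ ?_ ?_
  · filter_upwards [Ioo_mem_nhdsLT_one] with r hr
    have h1 : Continuous fun θ : ℝ => G (r * circleMap 0 1 θ) :=
      hG.continuousOn.comp_continuous (by fun_prop) fun θ => by
        simpa using norm_ofReal_mul_lt hr.1 hr.2
          (mem_sphere_zero_iff_norm.1 (circleMap_mem_unit θ)).le
    exact (hKc.mul (Complex.continuous_re.comp h1)).aestronglyMeasurable
  · filter_upwards [Ioo_mem_nhdsLT_one] with r hr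
    refine ae_of_all _ fun θ _ => ?_
    rw [norm_mul]
    gcongr
    exact (Complex.abs_re_le_norm _).trans (hB _ (norm_ofReal_mul_lt hr.1 hr.2
      (mem_sphere_zero_iff_norm.1 (circleMap_mem_unit θ)).le))
  · exact (hKc.norm.mul continuous_const).intervalIntegrable _ _
  -- Radial limits are available off the corners `±1` only, a null set of parameters.
  · have hc := (((countable_singleton (1 : ℂ)).insert (-1)).preimage_circleMap 0
      one_ne_zero).measure_zero volume
    filter_upwards [compl_mem_ae_iff.2 hc] with θ hθ _
    have hn : ‖circleMap 0 1 θ‖ = 1 := mem_sphere_zero_iff_norm.1 (circleMap_mem_unit θ)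
    refine (hlim _ hn fun him => hθ ?_).const_mul _
    have hsq : ‖circleMap 0 1 θ‖ ^ 2 = (circleMap 0 1 θ).re ^ 2 + (circleMap 0 1 θ).im ^ 2 := by
      rw [Complex.sq_norm, Complex.normSq_apply]; ring
    rw [hn, him] at hsq
    have hre : (circleMap 0 1 θ).re = 1 ∨ (circleMap 0 1 θ).re = -1 := by
      have : (circleMap 0 1 θ).re ^ 2 = 1 := by linarith
      exact mul_self_eq_one_iff.1 (by rw [← sq]; exact this)
    rcases hre with h1 | h1
    · exact Or.inr (Complex.ext h1 him)
    · exact Or.inl (Complex.ext h1 (by simpa using him))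

lemma BoundedHolderOn.of_norm_sub_le {E F : Type*} [NormedAddCommGroup E] [NormedAddCommGroup F]
    {f : ℂ → E} {g : ℂ → F} {S T : Set ℂ} (hf : BoundedHolderOn f T) (hST : S ⊆ T)
    (h : ∀ p ∈ S, ∀ q ∈ S, ‖g p - g q‖ ≤ ‖f p - f q‖) (hb : ∀ p ∈ S, ‖g p‖ ≤ ‖f p‖) :
    BoundedHolderOn g S := by
  refine ⟨fun K hKS hK => ?_, ?_⟩
  · obtain ⟨C, r, h0, h1, hH⟩ := hf.1 K (hKS.trans hST) hK
    exact ⟨C, r, h0, h1, holderOnWith_of_norm_sub_le fun p hp q hq =>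
      (h p (hKS hp) q (hKS hq)).trans (HolderOnWith.norm_sub_le hH hp hq)⟩
  · obtain ⟨M, hM⟩ := hf.2
    exact ⟨M, fun z hz => (hb z hz).trans (hM z (hST hz))⟩

/-! ### From a Hilbert pair to a solution -/

section HilbertPair

variable {β : ℝ} {φ₁ φ₂ : ℂ → ℂ} {u : ℂ → ℝ}

lemma IsHilbertPair.boundedHolderOn_re (hp : IsHilbertPair β φ₁ φ₂)
    (hu : ∀ t ∈ arc, (φ₂ t).re = u t) : BoundedHolderOn u arc := by
  refine hp.holder₂.of_norm_sub_le arc_subset_closedHalfDisc (fun p hp' q hq => ?_)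
    fun p hp' => ?_
  · rw [← hu p hp', ← hu q hq, ← Complex.sub_re]
    exact Complex.abs_re_le_norm _
  · rw [← hu p hp']
    exact Complex.abs_re_le_norm _

/-- The combination of a Hilbert pair that is the Schwarz integral of `Re φ₂` in the half-disc. -/
def upperPart (β : ℝ) (φ₁ φ₂ : ℂ → ℂ) (z : ℂ) : ℂ := φ₂ z + ((β / (1 - β) : ℝ) : ℂ) * φ₁ z

/-- The combination of a Hilbert pair that is the reflected Schwarz integral in the half-disc. -/
def lowerPart (β : ℝ) (φ₁ : ℂ → ℂ) (z : ℂ) : ℂ := ((1 / (1 - β) : ℝ) : ℂ) * φ₁ z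

/-- The coefficients are chosen for this: after clearing `1 - β`, equality of real parts is the
first diameter condition and equality of imaginary parts is the second. -/
lemma IsHilbertPair.upperPart_eq_conj (hp : IsHilbertPair β φ₁ φ₂) (hβ : β ≠ 1) {x : ℝ}
    (hx : |x| < 1) : upperPart β φ₁ φ₂ x = starRingEnd ℂ (lowerPart β φ₁ x) := by
  have h1 := hp.re_diameter x (abs_lt.1 hx)
  have h2 := hp.im_diameter x (abs_lt.1 hx)
  have h3 : (1 - β) ≠ 0 := sub_ne_zero.2 hβ.symm
  rw [Complex.sub_re] at h1
  rw [Complex.add_im, Complex.im_ofReal_mul] at h2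
  apply Complex.ext
  · rw [upperPart, lowerPart, Complex.conj_re, Complex.add_re, Complex.re_ofReal_mul,
      Complex.re_ofReal_mul, ← sub_eq_zero.1 h1]
    field_simp
    ring
  · rw [upperPart, lowerPart, Complex.conj_im, Complex.add_im, Complex.im_ofReal_mul,
      Complex.im_ofReal_mul]
    field_simp at h2 ⊢
    linarith

/-- By continuity the origin condition gives `φ₁ 0 = φ₂ 0`, so the second diameter condition at `0`
becomes `(β₀ + 1) Im φ₂ 0 = 0` with `β₀ + 1 = 2 / (1 - β) ≠ 0`. -/
lemma IsHilbertPair.im_zero (hp : IsHilbertPair β φ₁ φ₂) (hβ : β ≠ 1) :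
    (φ₁ 0).im = 0 ∧ (φ₂ 0).im = 0 := by
  have h0 : (0 : ℂ) ∈ closedHalfDisc := mem_closedHalfDisc_iff.2 (by simp)
  have hc : ContinuousWithinAt (fun z => φ₁ z - φ₂ z) halfDisc 0 :=
    ((hp.holder₁.continuousOn_closedHalfDisc.sub hp.holder₂.continuousOn_closedHalfDisc) 0 h0).mono
      halfDisc_subset_closedHalfDisc
  have hne : (𝓝[halfDisc] (0 : ℂ)).NeBot := by
    refine mem_closure_iff_nhdsWithin_neBot.1 (Metric.mem_closure_iff.2 fun ε hε => ?_)
    have hm : 0 < min (ε / 2) (1 / 2) := by positivity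
    refine ⟨((min (ε / 2) (1 / 2) : ℝ) : ℂ) * I, ⟨?_, by simpa using hm⟩, ?_⟩
    · rw [norm_mul, Complex.norm_I, mul_one, Complex.norm_real, Real.norm_of_nonneg hm.le]
      linarith [min_le_right (ε / 2) (1 / 2)]
    · rw [dist_zero_left, norm_mul, Complex.norm_I, mul_one, Complex.norm_real,
        Real.norm_of_nonneg hm.le]
      linarith [min_le_left (ε / 2) (1 / 2)]
  have h1 : φ₁ 0 = φ₂ 0 := sub_eq_zero.1 (tendsto_nhds_unique hc.tendsto hp.origin)
  have h2 := hp.im_diameter 0 (by simp)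
  have h3 : (1 - β) ≠ 0 := sub_ne_zero.2 hβ.symm
  rw [Complex.ofReal_zero, Complex.add_im, Complex.im_ofReal_mul, h1] at h2
  field_simp at h2
  have h4 : (φ₂ 0).im = 0 := by linarith
  exact ⟨by rw [h1, h4], h4⟩

lemma tendsto_radial {f : ℂ → ℂ} (hf : ContinuousOn f closedHalfDisc) {t : ℂ} (ht : t ∈ arc) :
    Tendsto (fun r : ℝ => f (r * t)) (𝓝[<] 1) (𝓝 (f t)) := by
  have h1 : Tendsto (fun r : ℝ => (r : ℂ) * t) (𝓝[<] 1) (𝓝[closedHalfDisc] t) := by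
    refine tendsto_nhdsWithin_iff.2 ⟨?_, ?_⟩
    · have : Continuous fun r : ℝ => (r : ℂ) * t := by fun_prop
      simpa using (this.tendsto 1).mono_left nhdsWithin_le_nhds
    · filter_upwards [Ioo_mem_nhdsLT_one] with r hr
      obtain ⟨hc, htc⟩ := mem_cutHalfDisc_of_mem (arc_subset_closedHalfDisc ht)
      exact cutHalfDisc_subset hc (mul_mem_cutHalfDisc htc hr.1.le hr.2.le)
  exact (hf t (arc_subset_closedHalfDisc ht)).tendsto.comp h1

/-- The two parts of a Hilbert pair are boundary pieces of one Schwarz integral. -/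
lemma IsHilbertPair.eqOn_schwarz (hp : IsHilbertPair β φ₁ φ₂) (hβ : β ≠ 1)
    (hu : ∀ t ∈ arc, (φ₂ t).re = u t) :
    EqOn (reflectGlue (upperPart β φ₁ φ₂) (lowerPart β φ₁)) (schwarz (upperDensity u))
      (ball 0 1) := by
  obtain ⟨M, h⟩ := (hp.boundedHolderOn_re hu).isDensity
  have c₁ := hp.holder₁.continuousOn_closedHalfDisc
  have c₂ := hp.holder₂.continuousOn_closedHalfDisc
  have cu : ContinuousOn (upperPart β φ₁ φ₂) closedHalfDisc := c₂.add (continuousOn_const.mul c₁)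
  have cl : ContinuousOn (lowerPart β φ₁) closedHalfDisc := continuousOn_const.mul c₁
  obtain ⟨M₁, hM₁⟩ := hp.holder₁.2
  obtain ⟨M₂, hM₂⟩ := hp.holder₂.2
  have hmem : ∀ z : ℂ, ‖z‖ < 1 → 0 ≤ z.im → z ∈ closedHalfDisc := fun z hz him =>
    mem_closedHalfDisc_iff.2 ⟨hz.le, him, (Complex.abs_re_le_norm z).trans_lt hz⟩
  have hM₁0 : 0 ≤ M₁ := (norm_nonneg _).trans (hM₁ 0 (hmem 0 (by simp) (by simp)))
  have hM₂0 : 0 ≤ M₂ := (norm_nonneg _).trans (hM₂ 0 (hmem 0 (by simp) (by simp)))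
  refine eqOn_schwarz_of_tendsto (M := M) (B := M₂ + |β / (1 - β)| * M₁ + |1 / (1 - β)| * M₁)
    (differentiableOn_reflectGlue (hp.analytic₂.add (hp.analytic₁.const_mul _))
      (hp.analytic₁.const_mul _) cu cl fun x hx => hp.upperPart_eq_conj hβ hx)
    h (fun z hz => ?_) (fun ζ hζ him => ?_) ?_
  · unfold reflectGlue
    split_ifs with him
    · have hz' := hmem z hz him
      rw [upperPart]
      refine (norm_add_le _ _).trans ?_
      rw [norm_mul, Complex.norm_real, Real.norm_eq_abs]
      have h1 : |β / (1 - β)| * ‖φ₁ z‖ ≤ |β / (1 - β)| * M₁ := by gcongr; exact hM₁ z hz'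
      have h2 : 0 ≤ |1 / (1 - β)| * M₁ := by positivity
      linarith [hM₂ z hz']
    · have hz' := hmem (starRingEnd ℂ z) (by simpa using hz) (by
        rw [Complex.conj_im]; linarith [not_le.1 him])
      rw [lowerPart, Complex.norm_conj, norm_mul, Complex.norm_real, Real.norm_eq_abs]
      have h1 : |1 / (1 - β)| * ‖φ₁ (starRingEnd ℂ z)‖ ≤ |1 / (1 - β)| * M₁ := by
        gcongr; exact hM₁ _ hz'
      have h2 : 0 ≤ |β / (1 - β)| * M₁ := by positivity
      linarith
  -- As `φ₁` is imaginary on the arc, the glued function has real part `0` on the lower half-circle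
  -- and `Re φ₂ = u` on the upper one.
  · rcases him.lt_or_gt with hi | hi
    · have ht : starRingEnd ℂ ζ ∈ arc := ⟨by simpa using hζ, by simpa using hi⟩
      have h1 := (Complex.continuous_re.tendsto _).comp (tendsto_radial cl ht)
      have h2 : (lowerPart β φ₁ (starRingEnd ℂ ζ)).re = upperDensity u ζ := by
        have h3 : ζ ∉ arc := fun h' => absurd h'.2 (not_lt.2 hi.le)
        rw [lowerPart, Complex.re_ofReal_mul, hp.re_arc _ ht, mul_zero, upperDensity,
          indicator_of_notMem h3]
      rw [h2] at h1
      refine h1.congr' ?_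
      filter_upwards [Ioo_mem_nhdsLT_one] with r hr
      have h3 : ¬ 0 ≤ ((r : ℂ) * ζ).im := by
        rw [Complex.im_ofReal_mul, not_le]; exact mul_neg_of_pos_of_neg hr.1 hi
      rw [reflectGlue, if_neg h3]
      simp
    · have ht : ζ ∈ arc := ⟨hζ, hi⟩
      have h1 := (Complex.continuous_re.tendsto _).comp (tendsto_radial cu ht)
      have h2 : (upperPart β φ₁ φ₂ ζ).re = upperDensity u ζ := by
        rw [upperPart, Complex.add_re, Complex.re_ofReal_mul, hp.re_arc _ ht, mul_zero, hu _ ht,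
          upperDensity, indicator_of_mem ht, add_zero]
      rw [h2] at h1
      refine h1.congr' ?_
      filter_upwards [Ioo_mem_nhdsLT_one] with r hr
      have h3 : 0 ≤ ((r : ℂ) * ζ).im := by
        rw [Complex.im_ofReal_mul]; exact mul_nonneg hr.1.le hi.le
      rw [reflectGlue, if_pos h3]
      rfl
  · obtain ⟨h1, h2⟩ := hp.im_zero hβ
    rw [reflectGlue, if_pos (by simp), upperPart, Complex.add_im, Complex.im_ofReal_mul, h1, h2]
    simp

/-- In the half-disc the two parts are `S` and `S*`, and `φ₂` is the first minus `β` times the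
second. -/
lemma IsHilbertPair.eq_schwarz_density₂ (hp : IsHilbertPair β φ₁ φ₂) (hβ : β ≠ 1)
    (hu : ∀ t ∈ arc, (φ₂ t).re = u t) {z : ℂ} (hz : z ∈ halfDisc) :
    schwarz (density₂ β u) z = φ₂ z := by
  obtain ⟨M, h⟩ := (hp.boundedHolderOn_re hu).isDensity
  have hG := hp.eqOn_schwarz hβ hu
  have h1 := hG (show z ∈ ball (0 : ℂ) 1 by simpa using hz.1)
  have h2 := hG (show starRingEnd ℂ z ∈ ball (0 : ℂ) 1 by simpa using hz.1)
  rw [reflectGlue, if_pos hz.2.le] at h1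
  rw [reflectGlue_of_im_nonpos (fun x hx => hp.upperPart_eq_conj hβ hx) (by simpa using hz.1)
    (by rw [Complex.conj_im]; linarith [hz.2]), Complex.conj_conj] at h2
  rw [schwarz_density₂ h hz.1, schwarz_lowerDensity h hz.1, ← h1, ← h2, Complex.conj_conj,
    upperPart, lowerPart]
  have h3 : (1 - (β : ℂ)) ≠ 0 := by
    have : (1 - β) ≠ 0 := sub_ne_zero.2 hβ.symm
    exact_mod_cast this
  push_cast
  field_simp
  ring

/-- A Hilbert pair yields a solution of the singular integral equation. -/
theorem IsHilbertPair.solvesIntegralEquation (hp : IsHilbertPair β φ₁ φ₂) (hβ : β ≠ 1)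
    (hu : ∀ t ∈ arc, (φ₂ t).re = u t) {v : ℂ → ℝ} (hv : ∀ t ∈ arc, v t = -(φ₂ t).im) :
    SolvesIntegralEquation β u v := by
  intro t ht
  have hu' := hp.boundedHolderOn_re hu
  obtain ⟨M, h⟩ := hu'.isDensity
  refine ⟨_, hasArcPV_density₂ hu' ht, ?_⟩
  obtain ⟨hc, htc⟩ := mem_cutHalfDisc_of_mem (arc_subset_closedHalfDisc ht)
  have hb : schwarzExt (density₂ β u) t = φ₂ t := by
    refine tendsto_nhds_unique
      (tendsto_schwarz_radial (isDensity₂ h) (holderOnArc_density₂ hu' h) hc htc)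
      ((tendsto_radial hp.holder₂.continuousOn_closedHalfDisc ht).congr' ?_)
    filter_upwards [Ioo_mem_nhdsLT_one] with r hr
    refine (hp.eq_schwarz_density₂ hβ hu ⟨norm_ofReal_mul_lt hr.1 hr.2 ht.1.le, ?_⟩).symm
    rw [Complex.im_ofReal_mul]
    exact mul_pos hr.1 ht.2
  have h2 : (π : ℂ) ≠ 0 := by exact_mod_cast Real.pi_ne_zero
  have h3 : φ₂ t - u t = (φ₂ t).im * I := by
    rw [← hu t ht]
    exact sub_eq_of_eq_add' (Complex.re_add_im _).symm
  rw [hb, h3, hv t ht]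
  field_simp
  rw [I_sq]
  push_cast
  ring

end HilbertPair

end HalfDiscSIE

end

theorem theorem2p1 (β : ℝ) (hβ : β ≠ 1) :
    (∀ (φ₁ φ₂ : ℂ → ℂ) (u v : ℂ → ℝ),
      HalfDiscSIE.IsHilbertPair β φ₁ φ₂ →
      (∀ t ∈ HalfDiscSIE.arc, (φ₂ t).re = u t) →
      (∀ t ∈ HalfDiscSIE.arc, v t = -(φ₂ t).im) →
        HalfDiscSIE.BoundedHolderOn u HalfDiscSIE.arc ∧
        HalfDiscSIE.SolvesIntegralEquation β u v) ∧
    (β ≠ -1 → ∀ u v : ℂ → ℝ,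
      HalfDiscSIE.BoundedHolderOn u HalfDiscSIE.arc →
      (∃ M : ℝ, ∀ t ∈ HalfDiscSIE.arc, |v t| ≤ M) →
      HalfDiscSIE.SolvesIntegralEquation β u v →
        ∃ Φ₁ Φ₂ : ℂ → ℂ,
          EqOn Φ₁ (HalfDiscSIE.cauchy₁ β u) HalfDiscSIE.halfDisc ∧
          EqOn Φ₂ (HalfDiscSIE.cauchy₂ β u) HalfDiscSIE.halfDisc ∧
          HalfDiscSIE.IsHilbertPair β Φ₁ Φ₂ ∧
          (∀ t ∈ HalfDiscSIE.arc, (Φ₂ t).im = -v t) ∧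
          (∀ t ∈ HalfDiscSIE.arc, (Φ₂ t).re = u t)) :=
  ⟨fun _ _ _ _ hp hu hv => ⟨hp.boundedHolderOn_re hu, hp.solvesIntegralEquation hβ hu hv⟩,
    fun hβ' _ _ hu hv hs => HalfDiscSIE.exists_isHilbertPair_of_solves hβ hβ' hu hv hs⟩
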